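/- **Theorem (Carleman estimate).** Let $n,m,Q$ be natural numbers, $B_1\subset\mathbb R^n$ the open unit ball, and let $\mathcal A_Q(\mathbb R^m)$ be the space of unordered $Q$-tuples $\sum_{i=1}^Q[\![P_i]\!]$ of points of $\mathbb R^m$ with the metric $\mathcal G(\sum_i[\![P_i]\!],\sum_i[\![S_i]\!])=\min_\sigma\big(\sum_i|P_i-S_{\sigma(i)}|^2\big)^{1/2}$. Let $f\in W^{1,2}(B_1;\mathcal A_Q(\mathbb R^m))$, i.e. there are nonnegative $\varphi_1,\dots,\varphi_n\in L^2(B_1)$ such that, for every $T\in\mathcal A_Q(\mathbb R^m)$, $\mathcal G(f,T)\in W^{1,2}(B_1)$ and $|\partial_j\mathcal G(f,T)|\le\varphi_j$ a.e. for all $j$. Write $f=\sum_i[\![f_i]\!]$ with a measurable selection $(f_i)$, and let $Df_i$ be the corresponding (measurable) approximate differentials: for a.e. $x$ one has $\mathcal G\big(f(y),\sum_i[\![f_i(x)+Df_i(x)(y-x)]\!]\big)=o(|y-x|)$ as $y\to x$ in a measurable set containing $x$ and of density one at $x$, and $Df_i(x)=Df_j(x)$ whenever $f_i(x)=f_j(x)$.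 Assume that $f$ is Dir-stationary in $B_1$, that is, $$\int_{B_1}\sum_i\big[\langle Df_i: D_x\psi(x,f_i)\rangle+\langle Df_i: D_u\psi(x,f_i)\cdot Df_i\rangle\big]\,dx=0$$ for every $\psi(x,u)\in C^\infty(B_1\times\mathbb R^m;\mathbb R^m)$ with compact support in $x$ such that, for some constant $K$, $|D_u\psi|\le K$ and $|\psi|+|D_x\psi|\le K(1+|u|)$, and $$2\int_{B_1}\sum_i\langle Df_i: Df_i\cdot D\phi\rangle-\int_{B_1}\sum_i|Df_i|^2\,\mathrm{div}\,\phi=0\qquad\text{for all }\phi\in C_c^\infty(B_1;\mathbb R^n).$$ Here $\langle A:B\rangle$ is the Hilbert–Schmidt product and $|A|^2=\langle A:A\rangle$. Then for every $\tau>0$, with $\eta=\frac{2\tau-n+2}{2}$, every $\epsilon>0$ and every real-valued $\chi\in C_c^\infty(B_1\setminus\{0\})$, $$\int_{B_1}\chi\sum_{i=1}^Q\left(\epsilon^2\frac{|f_i|^2}{|x|^{2\tau+2-\epsilon}}+\frac{|Df_i\cdot x-\eta f_i|^2}{|x|^{2\tau+2}}\right)dx\le C\int_{B_1}|D\chi|\sum_{i=1}^Q\left(\frac{|Df_i|^2}{|x|^{2\tau-1}}+\frac{|f_i|^2}{|x|^{2\tau+1}}\right)dx,$$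 where both integrands are integrable and $C=C_n\,(1+\tau+\tau^{-1}+\epsilon)$ with a constant $C_n>0$ that depends only on $n$ (not on $m,Q,f,\tau,\epsilon,\chi$). -/

import Mathlib

open MeasureTheory Filter Topology Asymptotics
open scoped ContDiff

namespace QVal

/-- Euclidean space `ℝᵏ`. -/
abbrev E (k : ℕ) : Type := EuclideanSpace ℝ (Fin k)

/-- The space `𝒜_Q(ℝᵐ)` of unordered `Q`-tuples of points of `ℝᵐ`. -/
abbrev AQ (Q m : ℕ) : Type := Sym (E m) Q

/-- The `Q`-point `∑ᵢ ⟦Pᵢ⟧`. -/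
def ofTuple {Q m : ℕ} (P : Fin Q → E m) : AQ Q m :=
  ⟨Finset.univ.val.map P, by simp⟩

/-- The distance `𝒢(S, T) = min_σ (∑ᵢ |Sᵢ - T_{σ(i)}|²)^{1/2}` on `𝒜_Q(ℝᵐ)`: the infimum over all
enumerations of the two `Q`-points (a finite nonempty set of values). -/
noncomputable def gDist {Q m : ℕ} (S T : AQ Q m) : ℝ :=
  sInf {d : ℝ | ∃ P R : Fin Q → E m, ofTuple P = S ∧ ofTuple R = T ∧
    d = Real.sqrt (∑ i, ‖P i - R i‖ ^ 2)}

/-- The `j`-th standard basis vector. -/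
noncomputable def basisVec {n : ℕ} (j : Fin n) : E n := EuclideanSpace.single j 1

/-- The Hilbert-Schmidt product `⟨A : B⟩` of linear maps. -/
noncomputable def hsInner {n m : ℕ} (A B : E n →L[ℝ] E m) : ℝ :=
  ∑ j, inner ℝ (A (basisVec j)) (B (basisVec j))

/-- The divergence of a vector field. -/
noncomputable def divergence {n : ℕ} (φ : E n → E n) (x : E n) : ℝ :=
  ∑ j, (fderiv ℝ φ x (basisVec j)) j

/-- `v` is the weak partial derivative `∂ⱼ h` on `Ω`. -/
def HasWeakPartial {n : ℕ} (Ω : Set (E n)) (j : Fin n) (h v : E n → ℝ) : Prop :=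
  ∀ ζ : E n → ℝ, ContDiff ℝ ∞ ζ → HasCompactSupport ζ → tsupport ζ ⊆ Ω →
    ∫ x in Ω, h x * fderiv ℝ ζ x (basisVec j) = - ∫ x in Ω, v x * ζ x

/-- `f ∈ W^{1,2}(Ω, 𝒜_Q(ℝᵐ))`: there are `φⱼ ∈ L²(Ω)`, `φⱼ ≥ 0`, such that for every `Q`-point `T`
the real function `x ↦ 𝒢(f(x), T)` lies in `W^{1,2}(Ω)` and `|∂ⱼ 𝒢(f, T)| ≤ φⱼ` a.e. -/
def MemW12 {n m Q : ℕ} (Ω : Set (E n)) (f : E n → AQ Q m) : Prop :=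
  ∃ φ : Fin n → E n → ℝ,
    (∀ j, MemLp (φ j) 2 (volume.restrict Ω) ∧ ∀ x, 0 ≤ φ j x) ∧
    ∀ T : AQ Q m, MemLp (fun x => gDist (f x) T) 2 (volume.restrict Ω) ∧
      ∀ j, ∃ v : E n → ℝ, MemLp v 2 (volume.restrict Ω) ∧
        HasWeakPartial Ω j (fun x => gDist (f x) T) v ∧
        ∀ᵐ x ∂(volume.restrict Ω), |v x| ≤ φ j x

/-- The set `A` has Lebesgue density `1` at `x`. -/
def HasDensityOne {n : ℕ} (A : Set (E n)) (x : E n) : Prop :=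
  Tendsto (fun r : ℝ => volume (A ∩ Metric.ball x r) / volume (Metric.ball x r))
    (𝓝[>] (0 : ℝ)) (𝓝 1)

/-- `f` is approximately differentiable at `x` with value `∑ᵢ ⟦Pᵢ⟧` and differentials `Lᵢ` paired
with the `Pᵢ`: on a measurable set of density one at `x` the map `f` agrees with
`y ↦ ∑ᵢ ⟦Pᵢ + Lᵢ (y - x)⟧` up to `o(|y - x|)`, and `Lᵢ = Lⱼ` whenever `Pᵢ = Pⱼ`. -/
def HasApproxDiffAt {n m Q : ℕ} (f : E n → AQ Q m) (x : E n)
    (P : Fin Q → E m) (L : Fin Q → E n →L[ℝ] E m) : Prop :=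
  f x = ofTuple P ∧
  (∃ A : Set (E n), MeasurableSet A ∧ x ∈ A ∧ HasDensityOne A x ∧
    (fun y => gDist (f y) (ofTuple fun i => P i + L i (y - x))) =o[𝓝[A] x] fun y => y - x) ∧
  ∀ i j, P i = P j → L i = L j

/-- `(fᵢ)` is a measurable selection of the `Q`-valued map `F` on `Ω`, and `(Dfᵢ)` are the
approximate differentials of `F`, paired with the `fᵢ`. These give a meaning to the symbols
`fᵢ`, `Dfᵢ` attached to `F`; at a.e. point they are determined by `F` up to a simultaneous
relabelling of the pairs `(fᵢ, Dfᵢ)`, which changes no sum over `i`. -/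
structure IsSelection {n m Q : ℕ} (Ω : Set (E n)) (F : E n → AQ Q m)
    (f : Fin Q → E n → E m) (Df : Fin Q → E n → E n →L[ℝ] E m) : Prop where
  meas : ∀ i, AEStronglyMeasurable (f i) (volume.restrict Ω)
  meas_diff : ∀ i, AEStronglyMeasurable (Df i) (volume.restrict Ω)
  approxDiff : ∀ᵐ x ∂(volume.restrict Ω),
    HasApproxDiffAt F x (fun i => f i x) (fun i => Df i x)

/-- Admissible outer variations: smooth `ψ(x, u)`, compactly supported in `x ∈ Ω`, with
`|D_u ψ| ≤ C` and `|ψ| + |D_x ψ| ≤ C (1 + |u|)`. -/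
def IsOuterTest {n m : ℕ} (Ω : Set (E n)) (ψ : E n → E m → E m) : Prop :=
  ContDiff ℝ ∞ (fun p : E n × E m => ψ p.1 p.2) ∧
  (∃ K : Set (E n), IsCompact K ∧ K ⊆ Ω ∧ ∀ x, x ∉ K → ∀ u, ψ x u = 0) ∧
  ∃ C : ℝ, ∀ x u, ‖fderiv ℝ (ψ x) u‖ ≤ C ∧
    ‖ψ x u‖ + ‖fderiv ℝ (fun y => ψ y u) x‖ ≤ C * (1 + ‖u‖)

/-- The outer variation `𝒪(f, ψ)`. -/
noncomputable def outerVar {n m Q : ℕ} (Ω : Set (E n)) (f : Fin Q → E n → E m)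
    (Df : Fin Q → E n → E n →L[ℝ] E m) (ψ : E n → E m → E m) : ℝ :=
  ∫ x in Ω, ∑ i, (hsInner (Df i x) (fderiv ℝ (fun y => ψ y (f i x)) x) +
    hsInner (Df i x) ((fderiv ℝ (ψ x) (f i x)).comp (Df i x)))

/-- The inner variation `ℐ(f, φ)`. -/
noncomputable def innerVar {n m Q : ℕ} (Ω : Set (E n))
    (Df : Fin Q → E n → E n →L[ℝ] E m) (φ : E n → E n) : ℝ :=
  2 * (∫ x in Ω, ∑ i, hsInner (Df i x) ((Df i x).comp (fderiv ℝ φ x))) -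
    ∫ x in Ω, (∑ i, hsInner (Df i x) (Df i x)) * divergence φ x

/-- The `Q`-valued map `F ∈ W^{1,2}(Ω, 𝒜_Q(ℝᵐ))`, written `F = ∑ᵢ ⟦fᵢ⟧` with differentials `Dfᵢ`,
is Dir-stationary: all outer and all inner variations vanish. -/
structure IsDirStationary {n m Q : ℕ} (Ω : Set (E n)) (F : E n → AQ Q m)
    (f : Fin Q → E n → E m) (Df : Fin Q → E n → E n →L[ℝ] E m) : Prop where
  memW12 : MemW12 Ω F
  selection : IsSelection Ω F f Df
  outer : ∀ ψ : E n → E m → E m, IsOuterTest Ω ψ → outerVar Ω f Df ψ = 0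
  inner : ∀ φ : E n → E n, ContDiff ℝ ∞ φ → HasCompactSupport φ → tsupport φ ⊆ Ω →
    innerVar Ω Df φ = 0

/-- The integrand
`χ ∑ᵢ (ε² |fᵢ|² / |x|^{2τ+2-ε} + |Dfᵢ·x - η fᵢ|² / |x|^{2τ+2})`, `η = (2τ - n + 2) / 2`. -/
noncomputable def carlemanLHS {n m Q : ℕ} (f : Fin Q → E n → E m)
    (Df : Fin Q → E n → E n →L[ℝ] E m) (τ ε : ℝ) (χ : E n → ℝ) (x : E n) : ℝ :=
  χ x * ∑ i, (ε ^ 2 * (‖f i x‖ ^ 2 / ‖x‖ ^ (2 * τ + 2 - ε)) +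
    ‖Df i x x - ((2 * τ - n + 2) / 2) • f i x‖ ^ 2 / ‖x‖ ^ (2 * τ + 2))

/-- The integrand `|Dχ| ∑ᵢ (|Dfᵢ|² / |x|^{2τ-1} + |fᵢ|² / |x|^{2τ+1})`. -/
noncomputable def carlemanRHS {n m Q : ℕ} (f : Fin Q → E n → E m)
    (Df : Fin Q → E n → E n →L[ℝ] E m) (τ : ℝ) (χ : E n → ℝ) (x : E n) : ℝ :=
  ‖fderiv ℝ χ x‖ * ∑ i, (hsInner (Df i x) (Df i x) / ‖x‖ ^ (2 * τ - 1) +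
    ‖f i x‖ ^ 2 / ‖x‖ ^ (2 * τ + 1))

end QVal

/-! Everything rests on three integral identities. Testing the outer variation with χ|x|^{-2τ}u, the
inner variation with χ|x|^{-2τ}x, and the weak gradient of ∑|fᵢ|² with χ|x|^{-2τ-2}x gives linear
relations between the weighted integrals KD of |Df|², KN of |Df·x|², KS of ⟨f, Df·x⟩ and KH of |f|²,
up to terms that contain Dχ. Eliminating KD leaves 4τ(KN - 2ηKS + η²KH) equal to Dχ-terms alone, and
the value of η is the one for which the bracket is the integral of the square |Df·x - ηf|². Young's
inequality with parameter |x| bounds the Dχ-terms by the right-hand side. Division by 4τ accounts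
for 1/τ, and the factor η for the growth in τ. This is `abs_le_of_variation_identities`.

For the mass term, the third identity with exponent -(2τ+2-ε) has the zeroth-order coefficient ε -
2η. Moving 2η to the other side produces ⟨f, Df·x - ηf⟩, which Young's inequality splits into a part
absorbed by ε∫|f|² and a multiple of the radial defect (`integral_mass_le`). This step needs χ ≥ 0.
A χ of variable sign is replaced by smooth approximations of its positive part, whose gradients are
bounded by an absolute multiple of |Dχ|.

The remaining work is to derive from the metric definition of W^{1,2} that fᵢ and Dfᵢ are square
integrable and that ∑|fᵢ|² has the weak gradient 2∑⟨fᵢ, Dfᵢ⟩ (`isSobolevSelection`). Weak gradients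
of 𝒢(f,T) control increments through averages over segments. Along a sequence t → 0, for almost all
points x and directions w, these averages converge and x + tw eventually lies in the set on which
the approximate differential describes f. Comparing both descriptions of the increment identifies
the two kinds of derivative. -/

namespace QVal

/-! ### The metric on unordered Q-tuples -/

section Metric

variable {Q m : ℕ}

theorem ofTuple_comp_perm (P : Fin Q → E m) (σ : Equiv.Perm (Fin Q)) :
    ofTuple (P ∘ σ) = ofTuple P := by
  apply Subtype.ext
  change Finset.univ.val.map (P ∘ σ) = Finset.univ.val.map P
  rw [← Multiset.map_map]
  congr 1
  simp

open Classical in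
-- Equal multisets give every value the same multiplicity, so the fibres of the two enumerations are
-- equinumerous and bijections between them glue to a permutation.
theorem exists_perm_of_ofTuple_eq {P R : Fin Q → E m} (h : ofTuple P = ofTuple R) :
    ∃ σ : Equiv.Perm (Fin Q), P = R ∘ σ := by
  have h' : Finset.univ.val.map P = Finset.univ.val.map R := congrArg Subtype.val h
  have hc : ∀ c, Nonempty ({a // P a = c} ≃ {b // R b = c}) := fun c => by
    refine ⟨Fintype.equivOfCardEq ?_⟩
    have := congrArg (Multiset.count c) h'
    rw [Multiset.count_map, Multiset.count_map] at this
    rw [Fintype.card_subtype, Fintype.card_subtype]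
    simpa only [Finset.card, Finset.filter_val, eq_comm] using this
  exact ⟨Equiv.ofFiberEquiv fun c => (hc c).some,
    funext fun a => (Equiv.ofFiberEquiv_map (fun c => (hc c).some) a).symm⟩

theorem exists_ofTuple_eq (S : AQ Q m) : ∃ P : Fin Q → E m, ofTuple P = S := by
  obtain ⟨s, hs⟩ := S
  induction s using Quotient.inductionOn with
  | h l =>
    change l.length = Q at hs
    subst hs
    refine ⟨fun i => l.get i, Subtype.ext ?_⟩
    change Finset.univ.val.map (fun i : Fin l.length => l.get i) = (l : Multiset (E m))
    rw [Fin.univ_val_map, List.ofFn_get]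

/-- The Euclidean distance of two ordered `Q`-tuples. -/
noncomputable def tupleDist (P R : Fin Q → E m) : ℝ := Real.sqrt (∑ i, ‖P i - R i‖ ^ 2)

theorem tupleDist_eq_norm (P R : Fin Q → E m) :
    tupleDist P R = ‖(WithLp.toLp 2 (fun i => P i - R i) : PiLp 2 fun _ : Fin Q => E m)‖ := by
  rw [PiLp.norm_eq_of_L2]
  rfl

theorem tupleDist_triangle (P R V : Fin Q → E m) :
    tupleDist P V ≤ tupleDist P R + tupleDist R V := by
  simp only [tupleDist_eq_norm]
  refine le_trans (le_of_eq ?_) (norm_add_le _ _)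
  congr 1
  ext i : 1
  simp

theorem tupleDist_comp_perm (P R : Fin Q → E m) (σ : Equiv.Perm (Fin Q)) :
    tupleDist (P ∘ σ) (R ∘ σ) = tupleDist P R := by
  unfold tupleDist
  congr 1
  exact Equiv.sum_comp σ fun i => ‖P i - R i‖ ^ 2

theorem norm_sub_le_tupleDist (P R : Fin Q → E m) (i : Fin Q) : ‖P i - R i‖ ≤ tupleDist P R := by
  apply Real.le_sqrt_of_sq_le
  exact Finset.single_le_sum (f := fun i => ‖P i - R i‖ ^ 2) (fun _ _ => sq_nonneg _)
    (Finset.mem_univ i)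

theorem gDist_bddBelow (S T : AQ Q m) : BddBelow {d : ℝ | ∃ P R : Fin Q → E m,
    ofTuple P = S ∧ ofTuple R = T ∧ d = Real.sqrt (∑ i, ‖P i - R i‖ ^ 2)} :=
  ⟨0, by rintro _ ⟨P, R, -, -, rfl⟩; exact Real.sqrt_nonneg _⟩

theorem gDist_le_tupleDist (P R : Fin Q → E m) :
    gDist (ofTuple P) (ofTuple R) ≤ tupleDist P R :=
  csInf_le (gDist_bddBelow _ _) ⟨P, R, rfl, rfl, rfl⟩

/-- Every `d` below all `tupleDist P (R ∘ σ)` is below `gDist`. -/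
theorem le_gDist {P R : Fin Q → E m} {d : ℝ}
    (h : ∀ σ : Equiv.Perm (Fin Q), d ≤ tupleDist P (R ∘ σ)) :
    d ≤ gDist (ofTuple P) (ofTuple R) := by
  refine le_csInf ⟨_, P, R, rfl, rfl, rfl⟩ ?_
  rintro _ ⟨P', R', hP, hR, rfl⟩
  obtain ⟨σ, hσ⟩ := exists_perm_of_ofTuple_eq hP
  obtain ⟨ρ, hρ⟩ := exists_perm_of_ofTuple_eq hR
  have := h (σ.symm.trans ρ)
  rw [← tupleDist_comp_perm _ _ σ] at this
  subst hσ hρ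
  exact this.trans_eq (by simp [tupleDist])

theorem exists_tupleDist_eq_gDist (P R : Fin Q → E m) :
    ∃ σ : Equiv.Perm (Fin Q), gDist (ofTuple P) (ofTuple R) = tupleDist P (R ∘ σ) := by
  obtain ⟨σ, hσ⟩ := Finite.exists_min fun σ : Equiv.Perm (Fin Q) => tupleDist P (R ∘ σ)
  refine ⟨σ, le_antisymm ?_ (le_gDist hσ)⟩
  rw [← ofTuple_comp_perm R σ]
  exact gDist_le_tupleDist _ _

theorem gDist_comm (S T : AQ Q m) : gDist S T = gDist T S := by
  unfold gDist
  congr 1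
  ext d
  constructor <;> rintro ⟨P, R, h1, h2, h3⟩ <;> refine ⟨R, P, h2, h1, ?_⟩ <;> rw [h3] <;>
    simp only [norm_sub_rev]

theorem gDist_triangle (S T U : AQ Q m) : gDist S U ≤ gDist S T + gDist T U := by
  obtain ⟨P, rfl⟩ := exists_ofTuple_eq S
  obtain ⟨R, rfl⟩ := exists_ofTuple_eq T
  obtain ⟨V, rfl⟩ := exists_ofTuple_eq U
  obtain ⟨σ, hσ⟩ := exists_tupleDist_eq_gDist P R
  obtain ⟨ρ, hρ⟩ := exists_tupleDist_eq_gDist R V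
  rw [hσ, hρ, ← tupleDist_comp_perm R _ σ, ← ofTuple_comp_perm V (σ.trans ρ)]
  exact (gDist_le_tupleDist _ _).trans (tupleDist_triangle _ _ _)

theorem abs_gDist_sub_le (S T U : AQ Q m) : |gDist S U - gDist T U| ≤ gDist S T := by
  rw [abs_sub_le_iff]
  have h1 := gDist_triangle S T U
  have h2 := gDist_triangle T S U
  rw [gDist_comm T S] at h2
  constructor <;> linarith

/-- The `Q`-point `Q ⟦0⟧`. -/
def zeroPt (Q m : ℕ) : AQ Q m := ofTuple fun _ => 0

theorem gDist_zeroPt (P : Fin Q → E m) :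
    gDist (ofTuple P) (zeroPt Q m) = Real.sqrt (∑ i, ‖P i‖ ^ 2) := by
  obtain ⟨σ, hσ⟩ := exists_tupleDist_eq_gDist P (fun _ => 0)
  rw [zeroPt, hσ]
  simp [tupleDist]

theorem gDist_zeroPt_sq (P : Fin Q → E m) :
    gDist (ofTuple P) (zeroPt Q m) ^ 2 = ∑ i, ‖P i‖ ^ 2 := by
  rw [gDist_zeroPt, Real.sq_sqrt (Finset.sum_nonneg fun _ _ => sq_nonneg _)]

/-- Any matching pairs the moved point P j + M j with some P i. If P i = P j the cost is ‖M j‖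
exactly; otherwise P i is so far away that the cost is still at least ‖M j‖. For small displacements
this lets 𝒢 see each differential separately. -/
theorem norm_le_gDist_add (P M : Fin Q → E m) (j : Fin Q)
    (hM : ∀ i, P i ≠ P j → 2 * ‖M j‖ ≤ ‖P i - P j‖) :
    ‖M j‖ ≤ gDist (ofTuple P) (ofTuple fun i => P i + M i) := by
  refine le_gDist fun σ => le_trans ?_ (norm_sub_le_tupleDist _ _ (σ.symm j))
  simp only [Function.comp_apply, Equiv.apply_symm_apply]
  by_cases h : P (σ.symm j) = P j
  · simp [h]
  · have h1 := hM _ h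
    have h2 := norm_sub_norm_le (P (σ.symm j) - P j) (M j)
    rw [sub_sub] at h2
    linarith

/-- A countable set of `Q`-points that is dense for `gDist`. -/
theorem exists_countable_gDist_dense (Q m : ℕ) : ∃ T : ℕ → AQ Q m, ∀ S, ∀ δ > 0,
    ∃ k, gDist S (T k) < δ := by
  obtain ⟨u, hu⟩ := TopologicalSpace.exists_dense_seq (Fin Q → E m)
  refine ⟨fun k => ofTuple (u k), fun S δ hδ => ?_⟩
  obtain ⟨P, rfl⟩ := exists_ofTuple_eq S
  have hcont : Continuous fun R => tupleDist P R := by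
    unfold tupleDist
    fun_prop
  have hopen : IsOpen {R | tupleDist P R < δ} := isOpen_lt hcont continuous_const
  obtain ⟨_, ⟨hR, k, rfl⟩⟩ := hu.inter_open_nonempty _ hopen ⟨P, by simpa [tupleDist] using hδ⟩
  exact ⟨k, (gDist_le_tupleDist _ _).trans_lt hR⟩

end Metric

/-! ### Translations and averages over segments in L² -/

section Averages

open scoped ENNReal

variable {n : ℕ} {F : Type*} [NormedAddCommGroup F]

theorem eLpNorm_two_sq {α : Type*} [MeasurableSpace α] (μ : Measure α) (g : α → F) :
    eLpNorm g 2 μ ^ 2 = ∫⁻ x, ‖g x‖ₑ ^ 2 ∂μ := by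
  have := eLpNorm_nnreal_pow_eq_lintegral (f := g) (μ := μ) (p := 2) (by norm_num)
  simpa using this

theorem tendsto_eLpNorm_two_iff {α ι : Type*} [MeasurableSpace α] {μ : Measure α} {l : Filter ι}
    {g : ι → α → F} :
    Tendsto (fun i => eLpNorm (g i) 2 μ) l (𝓝 0) ↔
      Tendsto (fun i => ∫⁻ x, ‖g i x‖ₑ ^ 2 ∂μ) l (𝓝 0) := by
  simp_rw [← eLpNorm_two_sq]
  constructor
  · intro h
    simpa using ENNReal.Tendsto.pow (n := 2) h
  · intro h
    have := (ENNReal.continuous_rpow_const (y := 1 / 2)).tendsto 0 |>.comp h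
    simp only [Function.comp_def] at this
    rw [ENNReal.zero_rpow_of_pos (by norm_num)] at this
    refine this.congr fun i => ?_
    rw [← ENNReal.rpow_natCast, ← ENNReal.rpow_mul]
    norm_num

theorem sq_lintegral_le {α : Type*} [MeasurableSpace α] (μ : Measure α) [IsProbabilityMeasure μ]
    {u : α → ℝ≥0∞} (hu : AEMeasurable u μ) : (∫⁻ s, u s ∂μ) ^ 2 ≤ ∫⁻ s, u s ^ 2 ∂μ := by
  have h := ENNReal.lintegral_mul_le_Lp_mul_Lq μ Real.HolderConjugate.two_two hu
    (aemeasurable_const (b := (1 : ℝ≥0∞)))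
  simp only [Pi.mul_apply, mul_one, ENNReal.one_rpow, lintegral_const, measure_univ] at h
  calc (∫⁻ s, u s ∂μ) ^ 2 ≤ ((∫⁻ s, u s ^ (2 : ℝ) ∂μ) ^ (1 / 2 : ℝ)) ^ 2 := by gcongr
    _ = ∫⁻ s, u s ^ 2 ∂μ := by
      rw [← ENNReal.rpow_natCast, ← ENNReal.rpow_mul]
      simp

/-- Lebesgue measure on the unit interval. -/
noncomputable abbrev unitMeas : Measure ℝ := volume.restrict (Set.Icc 0 1)

instance : IsProbabilityMeasure unitMeas := ⟨by simp⟩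

/-- Continuity of translations in L², from the joint continuity of composition with
measure-preserving maps. -/
theorem tendsto_translate_sub {g : E n → F} (hg : MemLp g 2 volume) :
    Tendsto (fun z => ∫⁻ x, ‖g (x + z) - g x‖ₑ ^ 2) (𝓝 0) (𝓝 0) := by
  rw [← tendsto_eLpNorm_two_iff (g := fun z x => g (x + z) - g x)]
  let T : E n → C(E n, E n) := fun z => ⟨fun x => x + z, by fun_prop⟩
  have hT : Continuous T := by
    apply ContinuousMap.continuous_of_continuous_uncurry
    change Continuous fun p : E n × E n => p.2 + p.1
    fun_prop
  have hmp : ∀ z, MeasurePreserving (T z) volume volume := fun z =>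
    measurePreserving_add_right volume z
  have : Fact ((1 : ℝ≥0∞) ≤ 2) := ⟨by norm_num⟩
  have h := (tendsto_const_nhds (x := hg.toLp g) (f := 𝓝 (0 : E n))).compMeasurePreservingLp
    (hT.tendsto 0) hmp (hmp 0) (by norm_num)
  rw [Lp.tendsto_Lp_iff_tendsto_eLpNorm'] at h
  refine h.congr fun z => eLpNorm_congr_ae ?_
  have h1 := Lp.coeFn_compMeasurePreserving (hg.toLp g) (hmp z)
  have h2 := Lp.coeFn_compMeasurePreserving (hg.toLp g) (hmp 0)
  have h3 := (hmp z).quasiMeasurePreserving.ae_eq_comp hg.coeFn_toLp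
  have h4 := (hmp 0).quasiMeasurePreserving.ae_eq_comp hg.coeFn_toLp
  filter_upwards [h1, h2, h3, h4] with x h1 h2 h3 h4
  simp only [Pi.sub_apply]
  rw [h1, h2, h3, h4]
  simp [T]

/-- Lets Fubini-type arguments move between statements at x and statements at x + c(a):
integrability and null sets pass through the shear. -/
theorem measurePreserving_shear {α : Type*} [MeasurableSpace α] (μ : Measure α) [SFinite μ]
    {c : α → E n} (hc : Measurable c) :
    MeasurePreserving (fun p : α × E n => (p.1, p.2 + c p.1)) (μ.prod volume) (μ.prod volume) :=
  (MeasurePreserving.id μ).skew_product (g := fun a x => x + c a)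
    (measurable_snd.add (hc.comp measurable_fst))
    (ae_of_all _ fun a => (measurePreserving_add_right volume (c a)).map_eq)

theorem quasiMeasurePreserving_shear {α : Type*} [MeasurableSpace α] (μ : Measure α) [SFinite μ]
    {c : α → E n} (hc : Measurable c) :
    Measure.QuasiMeasurePreserving (fun p : α × E n => p.2 + c p.1) (μ.prod volume) volume :=
  Measure.quasiMeasurePreserving_snd.comp (measurePreserving_shear μ hc).quasiMeasurePreserving

theorem integrable_shear {α : Type*} [MeasurableSpace α] (μ : Measure α) [IsFiniteMeasure μ]
    {c : α → E n} (hc : Measurable c) {g : E n → F} (hg : Integrable g) :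
    Integrable (fun p : α × E n => g (p.2 + c p.1)) (μ.prod volume) :=
  ((measurePreserving_shear μ hc).integrable_comp_of_integrable (g := fun p : α × E n => g p.2)
    (hg.comp_snd μ))

theorem ae_integrable_seg {g : E n → F} (hg : Integrable g) (z : E n) :
    ∀ᵐ x, Integrable (fun s : ℝ => g (x + s • z)) unitMeas :=
  (integrable_shear unitMeas (c := fun s => s • z) (by fun_prop) hg).prod_left_ae

variable [NormedSpace ℝ F]

/-- The average of `g` over the segment from `x` to `x + z`. -/
noncomputable def segAvg (g : E n → F) (z x : E n) : F := ∫ s, g (x + s • z) ∂unitMeas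

theorem integrable_segAvg {g : E n → F} (hg : Integrable g) (z : E n) :
    Integrable (segAvg g z) :=
  (integrable_shear unitMeas (c := fun s => s • z) (by fun_prop) hg).integral_prod_right

theorem stronglyMeasurable_segAvg {g : E n → F} (hg : StronglyMeasurable g) :
    StronglyMeasurable fun p : E n × E n => segAvg g p.1 p.2 := by
  unfold segAvg
  apply StronglyMeasurable.integral_prod_right
  exact hg.comp_measurable (by fun_prop)

/-- Jensen's inequality on the segment followed by Tonelli; the inner integral on the right is then
small by continuity of translations. -/
theorem lintegral_segAvg_sub_le [CompleteSpace F] {g : E n → F} (hg : StronglyMeasurable g)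
    (hi : Integrable g) (z : E n) :
    ∫⁻ x, ‖segAvg g z x - g x‖ₑ ^ 2 ≤
      ∫⁻ s, (∫⁻ x, ‖g (x + s • z) - g x‖ₑ ^ 2) ∂unitMeas := by
  have hm : Measurable fun p : ℝ × E n => ‖g (p.2 + p.1 • z) - g p.2‖ₑ :=
    ((hg.comp_measurable (by fun_prop)).sub (hg.comp_measurable (by fun_prop))).enorm
  rw [lintegral_lintegral_swap (hm.pow_const 2).aemeasurable]
  refine lintegral_mono_ae ?_
  filter_upwards [ae_integrable_seg hi z] with x hx
  have : segAvg g z x - g x = ∫ s, (g (x + s • z) - g x) ∂unitMeas := by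
    rw [integral_sub hx (integrable_const _)]
    simp [segAvg]
  rw [this]
  have hmx : Measurable fun s : ℝ => ‖g (x + s • z) - g x‖ₑ :=
    hm.comp (g := fun p : ℝ × E n => ‖g (p.2 + p.1 • z) - g p.2‖ₑ)
      (measurable_prodMk_right (y := x))
  exact (pow_le_pow_left' (enorm_integral_le_lintegral_enorm _) 2).trans
    (sq_lintegral_le unitMeas hmx.aemeasurable)

theorem eventually_lintegral_segAvg_sub_le [CompleteSpace F] {g : E n → F}
    (hg : StronglyMeasurable g) (hi : Integrable g) (h2 : MemLp g 2 volume) {δ : ℝ≥0∞}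
    (hδ : 0 < δ) : ∃ r > 0, ∀ z : E n, ‖z‖ < r → ∫⁻ x, ‖segAvg g z x - g x‖ₑ ^ 2 ≤ δ := by
  have h := (ENNReal.tendsto_nhds_zero.1 (tendsto_translate_sub h2)) δ hδ
  obtain ⟨r, hr, h⟩ := Metric.eventually_nhds_iff.1 h
  refine ⟨r, hr, fun z hz => (lintegral_segAvg_sub_le hg hi z).trans ?_⟩
  calc ∫⁻ s, (∫⁻ x, ‖g (x + s • z) - g x‖ₑ ^ 2) ∂unitMeas ≤ ∫⁻ _, δ ∂unitMeas := by
        refine lintegral_mono_ae ((ae_restrict_mem measurableSet_Icc).mono fun s hs => h ?_)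
        rw [dist_zero_right, norm_smul, Real.norm_of_nonneg hs.1]
        exact (mul_le_of_le_one_left (norm_nonneg _) hs.2).trans_lt hz
    _ = δ := by simp

theorem tendsto_segAvg_sub [CompleteSpace F] {g : E n → F}
    (hg : StronglyMeasurable g) (hi : Integrable g) (h2 : MemLp g 2 volume) :
    Tendsto (fun z => ∫⁻ x, ‖segAvg g z x - g x‖ₑ ^ 2) (𝓝 0) (𝓝 0) := by
  refine ENNReal.tendsto_nhds_zero.2 fun δ hδ => ?_
  obtain ⟨r, hr, h⟩ := eventually_lintegral_segAvg_sub_le hg hi h2 hδ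
  exact Metric.eventually_nhds_iff.2 ⟨r, hr, fun z hz => h z (by simpa using hz)⟩

/-- Lebesgue measure on the unit ball. -/
noncomputable abbrev ballMeas (n : ℕ) : Measure (E n) := volume.restrict (Metric.ball 0 1)

instance : IsFiniteMeasure (ballMeas n) := ⟨by simpa using measure_ball_lt_top⟩

/-- Segment averages of an `L²` function with endpoint `x + t w` converge, along a subsequence of
`t → 0`, for almost all `x` and almost all directions `w`. -/
theorem exists_seq_tendsto_segAvg [CompleteSpace F] {g : E n → F}
    (hg : StronglyMeasurable g) (hi : Integrable g) (h2 : MemLp g 2 volume) {t : ℕ → ℝ}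
    (ht : Tendsto t atTop (𝓝 0)) : ∃ ns : ℕ → ℕ, StrictMono ns ∧ ∀ᵐ x, ∀ᵐ w ∂ballMeas n,
      Tendsto (fun k => segAvg g (t (ns k) • w) x) atTop (𝓝 (g x)) := by
  have hm : ∀ k, StronglyMeasurable fun p : E n × E n => segAvg g (t k • p.2) p.1 := fun k =>
    (stronglyMeasurable_segAvg hg).comp_measurable (g := fun p : E n × E n => (t k • p.2, p.1))
      (by fun_prop)
  have hm' : StronglyMeasurable fun p : E n × E n => g p.1 := hg.comp_measurable (by fun_prop)
  -- Convergence in L² of the product over (x, w) gives convergence in measure, hence almost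
  -- everywhere along a subsequence. Working on the product makes one subsequence serve almost all
  -- pairs.
  have key : TendstoInMeasure (volume.prod (ballMeas n))
      (fun k (p : E n × E n) => segAvg g (t k • p.2) p.1) atTop (fun p => g p.1) := by
    refine tendstoInMeasure_of_tendsto_eLpNorm (p := 2) (by norm_num)
      (fun k => (hm k).aestronglyMeasurable) hm'.aestronglyMeasurable ?_
    refine (tendsto_eLpNorm_two_iff (g := fun k (p : E n × E n) =>
      segAvg g (t k • p.2) p.1 - g p.1)).2 ?_
    refine ENNReal.tendsto_nhds_zero.2 fun δ hδ => ?_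
    obtain ⟨δ', hδ', hle⟩ : ∃ δ' > 0, δ' * ballMeas n Set.univ ≤ δ := by
      refine ⟨δ / (ballMeas n Set.univ + 1), ENNReal.div_pos hδ.ne' (by finiteness), ?_⟩
      rw [div_eq_mul_inv, mul_assoc]
      refine mul_le_of_le_one_right' ?_
      rw [mul_comm, ← div_eq_mul_inv]
      exact ENNReal.div_le_of_le_mul (by simp)
    obtain ⟨r, hr, h⟩ := eventually_lintegral_segAvg_sub_le hg hi h2 hδ'
    filter_upwards [(Metric.tendsto_nhds.1 ht) r hr] with k hk
    rw [dist_zero_right] at hk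
    have hms : Measurable fun p : E n × E n => ‖segAvg g (t k • p.2) p.1 - g p.1‖ₑ ^ 2 :=
      ((hm k).sub hm').enorm.pow_const 2
    rw [lintegral_prod_symm _ hms.aemeasurable]
    calc ∫⁻ w, (∫⁻ x, ‖segAvg g (t k • w) x - g x‖ₑ ^ 2) ∂ballMeas n ≤ ∫⁻ _, δ' ∂ballMeas n := by
          refine lintegral_mono_ae ((ae_restrict_mem measurableSet_ball).mono fun w hw => h _ ?_)
          rw [norm_smul]
          rw [mem_ball_zero_iff] at hw
          exact (mul_le_of_le_one_right (norm_nonneg _) hw.le).trans_lt hk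
      _ = δ' * ballMeas n Set.univ := by rw [lintegral_const]
      _ ≤ δ := hle
  obtain ⟨ns, hns, hlim⟩ := key.exists_seq_tendsto_ae
  exact ⟨ns, hns, Measure.ae_ae_of_ae_prod hlim⟩

end Averages

/-! ### Weak gradients: increments along segments and the square rule -/

section WeakGradient

open scoped ENNReal

variable {n : ℕ}

/-- `h ∈ L¹ ∩ L²` has the weak gradient `v ∈ L¹ ∩ L²` on `Ω`; both functions are defined on the
whole space and measurable. -/
structure HasWeakGrad (Ω : Set (E n)) (h : E n → ℝ) (v : E n → E n) : Prop where
  meas : StronglyMeasurable h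
  meas_grad : StronglyMeasurable v
  int : Integrable h
  int_grad : Integrable v
  memLp : MemLp h 2 volume
  memLp_grad : MemLp v 2 volume
  weak : ∀ ζ : E n → ℝ, ContDiff ℝ ∞ ζ → HasCompactSupport ζ → tsupport ζ ⊆ Ω →
    ∀ z, ∫ x, h x * fderiv ℝ ζ x z = - ∫ x, inner ℝ z (v x) * ζ x

theorem sub_eq_integral_fderiv {ζ : E n → ℝ} (hζ : ContDiff ℝ ∞ ζ) (x z : E n) :
    ζ (x - z) - ζ x = - ∫ s, fderiv ℝ ζ (x - s • z) z ∂unitMeas := by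
  have hd : ∀ s : ℝ, HasDerivAt (fun s : ℝ => ζ (x - s • z)) (- fderiv ℝ ζ (x - s • z) z) s := by
    intro s
    have h1 : HasDerivAt (fun s : ℝ => x - s • z) (-z) s := by
      simpa using ((hasDerivAt_id s).smul_const z).const_sub x
    have := ((hζ.differentiable (by simp)) (x - s • z)).hasFDerivAt.comp_hasDerivAt s h1
    rwa [map_neg] at this
  have hc : Continuous fun s : ℝ => - fderiv ℝ ζ (x - s • z) z := by
    have := hζ.continuous_fderiv (by simp)
    fun_prop
  have h := intervalIntegral.integral_eq_sub_of_hasDerivAt (a := 0) (b := 1) (fun s _ => hd s)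
    (hc.intervalIntegrable _ _)
  rw [intervalIntegral.integral_of_le zero_le_one, ← integral_Icc_eq_integral_Ioc,
    integral_neg] at h
  simpa using h.symm

theorem tsupport_comp_sub_subset {ζ : E n → ℝ} (z : E n) {S : Set (E n)}
    (h : ∀ x ∈ tsupport ζ, x + z ∈ S) : tsupport (fun x => ζ (x - z)) ⊆ S := by
  intro x hx
  have : x - z ∈ tsupport ζ :=
    tsupport_comp_subset_preimage ζ (f := fun x => x - z) (by fun_prop) hx
  simpa using h _ this

theorem exists_norm_fderiv_le {ζ : E n → ℝ} (hζ : ContDiff ℝ ∞ ζ) (hc : HasCompactSupport ζ) :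
    ∃ C, ∀ x, ‖fderiv ℝ ζ x‖ ≤ C :=
  (hζ.continuous_fderiv (by simp)).bounded_above_of_compact_support (hc.fderiv (𝕜 := ℝ))

/-- The weak formula is applied to each translate ζ(· - sz) with s in [0,1] and integrated in s. The
hypothesis on segments keeps all these translates supported in Ω. -/
theorem HasWeakGrad.integral_translate_sub_mul {Ω : Set (E n)} {h : E n → ℝ} {v : E n → E n}
    (H : HasWeakGrad Ω h v) {ζ : E n → ℝ} (hζ : ContDiff ℝ ∞ ζ) (hc : HasCompactSupport ζ)
    (z : E n) (hz : ∀ x ∈ tsupport ζ, ∀ s ∈ Set.Icc (0 : ℝ) 1, x + s • z ∈ Ω) :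
    ∫ x, (ζ (x - z) - ζ x) * h x = ∫ x, ζ x * inner ℝ z (segAvg v z x) := by
  obtain ⟨C, hC⟩ := exists_norm_fderiv_le hζ hc
  obtain ⟨C', hC'⟩ := hζ.continuous.bounded_above_of_compact_support hc
  have hcf := hζ.continuous_fderiv (by simp)
  have hprod : Integrable (fun p : E n × ℝ => fderiv ℝ ζ (p.1 - p.2 • z) z * h p.1)
      (volume.prod unitMeas) := by
    refine (H.int.comp_fst unitMeas).bdd_mul (c := C * ‖z‖) ?_ (ae_of_all _ fun p => ?_)
    · exact Continuous.aestronglyMeasurable (by fun_prop)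
    · exact (ContinuousLinearMap.le_opNorm _ _).trans (by gcongr; exact hC _)
  have hprod_grad : Integrable (fun p : ℝ × E n => ζ p.2 * inner ℝ z (v (p.2 + p.1 • z)))
      (unitMeas.prod volume) := by
    refine ((integrable_shear unitMeas (c := fun s : ℝ => s • z) (by fun_prop)
      H.int_grad).const_inner z).bdd_mul (c := C') ?_ (ae_of_all _ fun p => hC' _)
    exact (hζ.continuous.comp continuous_snd).aestronglyMeasurable
  calc ∫ x, (ζ (x - z) - ζ x) * h x
      = ∫ x, - ∫ s, fderiv ℝ ζ (x - s • z) z * h x ∂unitMeas := by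
        simp_rw [sub_eq_integral_fderiv hζ, neg_mul, integral_mul_const]
    _ = - ∫ s, (∫ x, fderiv ℝ ζ (x - s • z) z * h x) ∂unitMeas := by
        rw [integral_neg, integral_integral_swap hprod]
    _ = ∫ s, (∫ x, ζ x * inner ℝ z (v (x + s • z))) ∂unitMeas := by
        rw [← integral_neg]
        refine integral_congr_ae ((ae_restrict_mem measurableSet_Icc).mono fun s hs => ?_)
        have hζ' : ContDiff ℝ ∞ fun x => ζ (x - s • z) := by fun_prop
        have hc' : HasCompactSupport fun x => ζ (x - s • z) := by
          simpa [sub_eq_add_neg, Function.comp_def] using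
            hc.comp_homeomorph (Homeomorph.addRight (-(s • z)))
        have hw := H.weak _ hζ' hc' (tsupport_comp_sub_subset (s • z) fun x hx => hz x hx s hs) z
        have hfd : ∀ x, fderiv ℝ (fun x => ζ (x - s • z)) x = fderiv ℝ ζ (x - s • z) :=
          fun x => by simpa [sub_eq_add_neg] using fderiv_comp_add_right (-(s • z))
        simp only [hfd] at hw
        have h1 : ∫ x, inner ℝ z (v x) * ζ (x - s • z) =
            ∫ x, inner ℝ z (v (x + s • z)) * ζ x := by
          rw [← integral_add_right_eq_self _ (s • z)]
          simp
        change - ∫ x, fderiv ℝ ζ (x - s • z) z * h x = ∫ x, ζ x * inner ℝ z (v (x + s • z))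
        simp_rw [mul_comm (fderiv ℝ ζ _ z), mul_comm (ζ _), ← h1, hw, neg_neg]
    _ = ∫ x, ζ x * inner ℝ z (segAvg v z x) := by
        rw [integral_integral_swap hprod_grad]
        refine integral_congr_ae ?_
        filter_upwards [ae_integrable_seg H.int_grad z] with x hx
        rw [integral_const_mul, integral_inner hx]
        rfl

/-- The fundamental lemma of the calculus of variations turns the integrated identity into a
pointwise one: a weak fundamental theorem of calculus along the fixed vector z. -/
theorem HasWeakGrad.ae_sub_eq {Ω U : Set (E n)} {h : E n → ℝ} {v : E n → E n}
    (H : HasWeakGrad Ω h v) (hU : IsOpen U) (z : E n)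
    (hz : ∀ x ∈ U, ∀ s ∈ Set.Icc (0 : ℝ) 1, x + s • z ∈ Ω) :
    ∀ᵐ x, x ∈ U → h (x + z) - h x = inner ℝ z (segAvg v z x) := by
  have hi1 : Integrable fun x => h (x + z) := H.int.comp_add_right z
  have hi2 : Integrable fun x => inner ℝ z (segAvg v z x) :=
    (integrable_segAvg H.int_grad z).const_inner z
  have hi := (hi1.sub H.int).sub hi2
  have := hU.ae_eq_zero_of_integral_contDiff_smul_eq_zero (μ := volume)
    (f := fun x => h (x + z) - h x - inner ℝ z (segAvg v z x))
    (hi.locallyIntegrable.locallyIntegrableOn U) ?_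
  · filter_upwards [this] with x hx hxU
    exact sub_eq_zero.1 (hx hxU)
  · intro ζ hζ hc hs
    obtain ⟨C', hC'⟩ := hζ.continuous.bounded_above_of_compact_support hc
    have hm : ∀ {u : E n → ℝ}, Integrable u → Integrable fun x => ζ x * u x := fun hu =>
      hu.bdd_mul hζ.continuous.aestronglyMeasurable (ae_of_all _ hC')
    have hi3 : Integrable fun x => ζ (x - z) * h x :=
      H.int.bdd_mul (by have := hζ.continuous; exact Continuous.aestronglyMeasurable (by fun_prop))
        (ae_of_all _ fun x => hC' _)
    have key := H.integral_translate_sub_mul hζ hc z fun x hx => hz x (hs hx)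
    have h1 : ∫ x, ζ (x - z) * h x = ∫ x, ζ x * h (x + z) := by
      rw [← integral_add_right_eq_self _ z]
      simp
    simp_rw [sub_mul] at key
    rw [integral_sub hi3 (hm H.int), h1] at key
    simp_rw [smul_eq_mul, mul_sub]
    have hi4 : Integrable fun x => ζ x * h (x + z) - ζ x * h x := (hm hi1).sub (hm H.int)
    rw [integral_sub hi4 (hm hi2), integral_sub (hm hi1) (hm H.int), key,
      sub_self]

/-- Continuity of the L² inner product. The approximating functions are only assumed measurable:
convergence puts them in L² from some index on, hence the shift by N. -/
theorem tendsto_integral_mul_of_eLpNorm {α : Type*} [MeasurableSpace α] {μ : Measure α}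
    {a b : ℕ → α → ℝ} {a' b' : α → ℝ} (ha : ∀ k, AEStronglyMeasurable (a k) μ)
    (hb : ∀ k, AEStronglyMeasurable (b k) μ) (ha' : MemLp a' 2 μ) (hb' : MemLp b' 2 μ)
    (hla : Tendsto (fun k => eLpNorm (a k - a') 2 μ) atTop (𝓝 0))
    (hlb : Tendsto (fun k => eLpNorm (b k - b') 2 μ) atTop (𝓝 0)) :
    Tendsto (fun k => ∫ x, a k x * b k x ∂μ) atTop (𝓝 (∫ x, a' x * b' x ∂μ)) := by
  have hev : ∀ {c : ℕ → α → ℝ} {c' : α → ℝ}, (∀ k, AEStronglyMeasurable (c k) μ) → MemLp c' 2 μ →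
      Tendsto (fun k => eLpNorm (c k - c') 2 μ) atTop (𝓝 0) → ∀ᶠ k in atTop, MemLp (c k) 2 μ := by
    intro c c' hc hc' hl
    filter_upwards [hl.eventually_lt_const one_pos] with k hk
    have h1 : MemLp (c k - c') 2 μ := ⟨(hc k).sub hc'.1, hk.trans ENNReal.one_lt_top⟩
    simpa using h1.add hc'
  obtain ⟨N, hN⟩ := eventually_atTop.1 ((hev ha ha' hla).and (hev hb hb' hlb))
  rw [← tendsto_add_atTop_iff_nat N]
  have hA : ∀ k, MemLp (a (k + N)) 2 μ := fun k => (hN _ (Nat.le_add_left _ _)).1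
  have hB : ∀ k, MemLp (b (k + N)) 2 μ := fun k => (hN _ (Nat.le_add_left _ _)).2
  have : Fact ((1 : ℝ≥0∞) ≤ 2) := ⟨by norm_num⟩
  have h1 := (Lp.tendsto_Lp_iff_tendsto_eLpNorm'' _ hA _ ha').2
    ((tendsto_add_atTop_iff_nat N).2 hla)
  have h2 := (Lp.tendsto_Lp_iff_tendsto_eLpNorm'' _ hB _ hb').2
    ((tendsto_add_atTop_iff_nat N).2 hlb)
  have hin : ∀ {c d : α → ℝ} (hc : MemLp c 2 μ) (hd : MemLp d 2 μ),
      inner ℝ (hd.toLp d) (hc.toLp c) = ∫ x, c x * d x ∂μ := by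
    intro c d hc hd
    rw [L2.inner_def]
    refine integral_congr_ae ?_
    filter_upwards [hc.coeFn_toLp, hd.coeFn_toLp] with x h1 h2
    rw [h1, h2]
    simp
  have := h2.inner (𝕜 := ℝ) h1
  simpa only [hin] using this

theorem tendsto_difference_quotient {ζ : E n → ℝ} (hζ : ContDiff ℝ ∞ ζ) (x z : E n) :
    Tendsto (fun t : ℝ => t⁻¹ * (ζ (x - t • z) - ζ x)) (𝓝[≠] 0) (𝓝 (- fderiv ℝ ζ x z)) := by
  have h1 : HasDerivAt (fun s : ℝ => x - s • z) (-z) 0 := by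
    simpa using ((hasDerivAt_id (0 : ℝ)).smul_const z).const_sub x
  have h2 : HasFDerivAt ζ (fderiv ℝ ζ x) (x - (0 : ℝ) • z) := by
    simpa using ((hζ.differentiable (by simp)) x).hasFDerivAt
  have h3 := (h2.comp_hasDerivAt (0 : ℝ) h1).tendsto_slope_zero
  simpa using h3

/-- The weak gradient of h² is 2hv. Factoring h(x+tz)² - h(x)² as a sum times a difference, and
writing the difference as t times a segment average of v, reduces the difference quotient to a
product of two L²-convergent factors. -/
theorem HasWeakGrad.integral_sq_mul_fderiv {Ω : Set (E n)} (hΩ : IsOpen Ω) {h : E n → ℝ}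
    {v : E n → E n} (H : HasWeakGrad Ω h v) {ζ : E n → ℝ} (hζ : ContDiff ℝ ∞ ζ)
    (hc : HasCompactSupport ζ) (hs : tsupport ζ ⊆ Ω) (z : E n) :
    ∫ x, h x ^ 2 * fderiv ℝ ζ x z = - ∫ x, 2 * (h x * inner ℝ z (v x)) * ζ x := by
  obtain ⟨C, hC⟩ := exists_norm_fderiv_le hζ hc
  obtain ⟨C', hC'⟩ := hζ.continuous.bounded_above_of_compact_support hc
  have hC0 : 0 ≤ C := (norm_nonneg _).trans (hC 0)
  have hcont := hζ.continuous
  set t : ℕ → ℝ := fun k => 1 / ((k : ℝ) + 1)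
  have htpos : ∀ k, 0 < t k := fun k => by positivity
  have ht : Tendsto t atTop (𝓝 0) := tendsto_one_div_add_atTop_nhds_zero_nat
  have ht' : Tendsto t atTop (𝓝[≠] 0) :=
    tendsto_nhdsWithin_iff.2 ⟨ht, Eventually.of_forall fun k => (htpos k).ne'⟩
  have htz : Tendsto (fun k => t k • z) atTop (𝓝 0) := by simpa using ht.smul_const z
  have hsq : Integrable fun x => h x ^ 2 := H.memLp.integrable_sq
  have left : Tendsto (fun k => ∫ x, ((t k)⁻¹ * (ζ (x - t k • z) - ζ x)) * h x ^ 2) atTop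
      (𝓝 (∫ x, - fderiv ℝ ζ x z * h x ^ 2)) := by
    refine tendsto_integral_of_dominated_convergence (fun x => (C * ‖z‖) * h x ^ 2)
      (fun k => ?_) (hsq.const_mul _) (fun k => ae_of_all _ fun x => ?_)
      (ae_of_all _ fun x => ((tendsto_difference_quotient hζ x z).comp ht').mul_const _)
    · exact (Continuous.aestronglyMeasurable (by fun_prop)).mul hsq.aestronglyMeasurable
    · rw [norm_mul, norm_mul, norm_pow, Real.norm_eq_abs (h x), sq_abs]
      refine mul_le_mul_of_nonneg_right ?_ (sq_nonneg _)
      have := Convex.norm_image_sub_le_of_norm_fderiv_le (𝕜 := ℝ) (f := ζ) (s := Set.univ)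
        (fun y _ => hζ.differentiable (by simp) y) (fun y _ => hC y) convex_univ
        (Set.mem_univ x) (Set.mem_univ (x - t k • z))
      rw [sub_sub_cancel_left, norm_neg, norm_smul] at this
      rw [norm_inv]
      calc ‖t k‖⁻¹ * ‖ζ (x - t k • z) - ζ x‖ ≤ ‖t k‖⁻¹ * (C * (‖t k‖ * ‖z‖)) := by gcongr
        _ = C * ‖z‖ := by
          have : ‖t k‖ ≠ 0 := norm_ne_zero_iff.2 (htpos k).ne'
          field_simp
  have right : Tendsto (fun k => ∫ x, (ζ x * (h (x + t k • z) + h x)) *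
      inner ℝ z (segAvg v (t k • z) x)) atTop
      (𝓝 (∫ x, (ζ x * (h x + h x)) * inner ℝ z (v x))) := by
    have hhm : ∀ k, AEStronglyMeasurable (fun x => h (x + t k • z)) volume := fun k =>
      (H.int.comp_add_right _).aestronglyMeasurable
    refine tendsto_integral_mul_of_eLpNorm (fun k => ?_) (fun k => ?_) ?_ ?_ ?_ ?_
    · exact hcont.aestronglyMeasurable.mul ((hhm k).add H.int.aestronglyMeasurable)
    · exact ((integrable_segAvg H.int_grad _).const_inner z).aestronglyMeasurable
    · refine (H.memLp.add H.memLp).of_le_mul (c := C')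
        (hcont.aestronglyMeasurable.mul (H.memLp.add H.memLp).1) (ae_of_all _ fun x => ?_)
      rw [norm_mul]
      exact mul_le_mul_of_nonneg_right (hC' x) (norm_nonneg _)
    · exact H.memLp_grad.const_inner z
    · have h0 := tendsto_eLpNorm_two_iff.2 ((tendsto_translate_sub H.memLp).comp htz)
      have h1 := ENNReal.Tendsto.const_mul (a := ENNReal.ofReal C') h0 (Or.inr (by simp))
      rw [mul_zero] at h1
      refine tendsto_of_tendsto_of_tendsto_of_le_of_le tendsto_const_nhds h1
        (fun _ => zero_le) fun k => ?_
      refine eLpNorm_le_mul_eLpNorm_of_ae_le_mul (ae_of_all _ fun x => ?_) 2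
      have : ζ x * (h (x + t k • z) + h x) - ζ x * (h x + h x) =
        ζ x * (h (x + t k • z) - h x) := by ring
      simp only [Pi.sub_apply, this, norm_mul]
      gcongr
      exact hC' x
    · have h0 := tendsto_eLpNorm_two_iff.2
        ((tendsto_segAvg_sub H.meas_grad H.int_grad H.memLp_grad).comp htz)
      have h1 := ENNReal.Tendsto.const_mul (a := ENNReal.ofReal ‖z‖) h0 (Or.inr (by simp))
      rw [mul_zero] at h1
      refine tendsto_of_tendsto_of_tendsto_of_le_of_le tendsto_const_nhds h1
        (fun _ => zero_le) fun k => ?_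
      refine eLpNorm_le_mul_eLpNorm_of_ae_le_mul (ae_of_all _ fun x => ?_) 2
      simp only [Pi.sub_apply, ← inner_sub_right]
      exact norm_inner_le_norm _ _
  -- The support has a margin δ inside Ω. Half of it provides an open neighbourhood U, the other
  -- half room for the segments issuing from U.
  obtain ⟨δ, hδ, hsub⟩ := (show IsCompact (tsupport ζ) from hc).exists_thickening_subset_open hΩ hs
  have heq : ∀ᶠ k in atTop, ∫ x, ((t k)⁻¹ * (ζ (x - t k • z) - ζ x)) * h x ^ 2 =
      ∫ x, (ζ x * (h (x + t k • z) + h x)) * inner ℝ z (segAvg v (t k • z) x) := by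
    filter_upwards [(Metric.tendsto_nhds.1 htz) (δ / 2) (half_pos hδ)] with k hk
    rw [dist_zero_right] at hk
    have hae := H.ae_sub_eq (U := Metric.thickening (δ / 2) (tsupport ζ))
      Metric.isOpen_thickening (t k • z) (by
        intro x hx s hs
        apply hsub
        rw [Metric.mem_thickening_iff] at hx ⊢
        obtain ⟨y, hy, hxy⟩ := hx
        refine ⟨y, hy, ?_⟩
        have h1 : dist (x + s • t k • z) x ≤ ‖t k • z‖ := by
          rw [dist_eq_norm, add_sub_cancel_left, norm_smul, Real.norm_of_nonneg hs.1]
          exact mul_le_of_le_one_left (norm_nonneg _) hs.2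
        linarith [dist_triangle (x + s • t k • z) x y])
    have hsq' : Integrable fun x => h (x + t k • z) ^ 2 := hsq.comp_add_right (t k • z)
    have hb : ∀ {u : E n → ℝ} (y : E n), Integrable u → Integrable fun x => ζ (x - y) * u x :=
      fun y hu => hu.bdd_mul (Continuous.aestronglyMeasurable (by fun_prop))
        (ae_of_all _ fun x => hC' _)
    have hb0 : ∀ {u : E n → ℝ}, Integrable u → Integrable fun x => ζ x * u x := fun hu => by
      simpa using hb 0 hu
    have h1 : ∫ x, ζ (x - t k • z) * h x ^ 2 = ∫ x, ζ x * h (x + t k • z) ^ 2 := by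
      rw [← integral_add_right_eq_self _ (t k • z)]
      simp
    have h2 : ∫ x, (ζ (x - t k • z) - ζ x) * h x ^ 2 =
        ∫ x, ζ x * (h (x + t k • z) ^ 2 - h x ^ 2) := by
      simp_rw [sub_mul, mul_sub]
      rw [integral_sub (hb _ hsq) (hb0 hsq), h1, integral_sub (hb0 hsq') (hb0 hsq)]
    simp_rw [mul_assoc (t k)⁻¹]
    rw [integral_const_mul, h2, ← integral_const_mul]
    refine integral_congr_ae ?_
    filter_upwards [hae] with x hx
    by_cases hxs : x ∈ tsupport ζ
    · have h3 := hx (Metric.self_subset_thickening (half_pos hδ) _ hxs)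
      rw [inner_smul_left] at h3
      have h4 : h (x + t k • z) ^ 2 - h x ^ 2 =
        (h (x + t k • z) + h x) * (h (x + t k • z) - h x) := by ring
      rw [h4, h3]
      have := (htpos k).ne'
      simp only [conj_trivial]
      field_simp
    · simp [image_eq_zero_of_notMem_tsupport hxs]
  have hlim := tendsto_nhds_unique (left.congr' heq) right
  have e1 : ∫ x, h x ^ 2 * fderiv ℝ ζ x z = - ∫ x, - fderiv ℝ ζ x z * h x ^ 2 := by
    rw [← integral_neg]
    exact integral_congr_ae (ae_of_all _ fun x => by ring)
  rw [e1, hlim]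
  congr 1
  exact integral_congr_ae (ae_of_all _ fun x => by ring)

end WeakGradient

/-! ### Blow-up at points of approximate differentiability -/

section BlowUp

open scoped ENNReal

variable {n m Q : ℕ}

theorem volume_dilate_inter_ball (A : Set (E n)) (x : E n) {t : ℝ} (ht : 0 < t) :
    volume ((fun w : E n => x + t • w) ⁻¹' A ∩ Metric.ball 0 1) =
      ENNReal.ofReal |(t ^ Module.finrank ℝ (E n))⁻¹| * volume (A ∩ Metric.ball x t) := by
  rw [← measure_preimage_add volume x (A ∩ Metric.ball x t),
    ← Measure.addHaar_preimage_smul volume ht.ne']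
  congr 1
  ext w
  simp only [Set.mem_inter_iff, Set.mem_preimage, mem_ball_iff_norm, sub_zero,
    add_sub_cancel_left, norm_smul, Real.norm_of_nonneg ht.le, and_congr_right_iff]
  intro _
  rw [mul_lt_iff_lt_one_right ht]

/-- Density one, rescaled by 1/t to the unit ball: the directions w with x + tw outside A have
vanishing measure. -/
theorem HasDensityOne.tendsto_measure_compl {A : Set (E n)} {x : E n} (h : HasDensityOne A x)
    (hA : MeasurableSet A) {t : ℕ → ℝ} (htpos : ∀ k, 0 < t k) (ht : Tendsto t atTop (𝓝 0)) :
    Tendsto (fun k => ballMeas n {w | x + t k • w ∉ A}) atTop (𝓝 0) := by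
  set B : Set (E n) := Metric.ball 0 1
  have hB0 : volume B ≠ 0 := (Metric.measure_ball_pos volume 0 one_pos).ne'
  have hBt : volume B ≠ ⊤ := measure_ball_lt_top.ne
  have hS : ∀ k, MeasurableSet ((fun w : E n => x + t k • w) ⁻¹' A) := fun k =>
    (show Measurable fun w : E n => x + t k • w by fun_prop) hA
  have h1 : Tendsto (fun k => volume ((fun w : E n => x + t k • w) ⁻¹' A ∩ B)) atTop
      (𝓝 (volume B)) := by
    have h2 := h.comp (tendsto_nhdsWithin_iff.2 ⟨ht, Eventually.of_forall htpos⟩)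
    have h3 := ENNReal.Tendsto.mul_const (b := volume B) h2 (Or.inr hBt)
    rw [one_mul] at h3
    refine h3.congr fun k => ?_
    have hu := volume_dilate_inter_ball Set.univ x (htpos k)
    rw [Set.preimage_univ, Set.univ_inter, Set.univ_inter] at hu
    have hc0 : ENNReal.ofReal |(t k ^ Module.finrank ℝ (E n))⁻¹| ≠ 0 := by
      have := htpos k
      simp only [ne_eq, ENNReal.ofReal_eq_zero, not_le]
      positivity
    simp only [Function.comp_apply]
    rw [← ENNReal.mul_div_mul_left _ _ hc0 ENNReal.ofReal_ne_top, ← hu,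
      ← volume_dilate_inter_ball A x (htpos k), ENNReal.div_mul_cancel hB0 hBt]
  have h4 := ENNReal.Tendsto.sub (tendsto_const_nhds (x := volume B)) h1 (Or.inl hBt)
  rw [tsub_self] at h4
  refine h4.congr fun k => ?_
  rw [Measure.restrict_apply' measurableSet_ball,
    ← measure_sdiff Set.inter_subset_right ((hS k).inter measurableSet_ball).nullMeasurableSet
    (measure_ne_top_of_subset Set.inter_subset_right hBt)]
  congr 1
  ext w
  simp only [Set.mem_sdiff, Set.mem_inter_iff, Set.mem_preimage, Set.mem_ofPred_eq]
  tauto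

/-- Along a subsequence of `t → 0`, almost every ray from a density point of `A` stays in `A`. -/
theorem HasDensityOne.exists_seq {A : Set (E n)} {x : E n} (h : HasDensityOne A x)
    (hA : MeasurableSet A) {t : ℕ → ℝ} (htpos : ∀ k, 0 < t k) (ht : Tendsto t atTop (𝓝 0)) :
    ∃ ns : ℕ → ℕ, StrictMono ns ∧ ∀ᵐ w ∂ballMeas n, ∀ᶠ k in atTop, x + t (ns k) • w ∈ A := by
  have key : TendstoInMeasure (ballMeas n)
      (fun k => Set.indicator {w : E n | x + t k • w ∉ A} (fun _ => (1 : ℝ))) atTop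
      (fun _ => 0) := by
    intro ε hε
    refine tendsto_of_tendsto_of_tendsto_of_le_of_le tendsto_const_nhds
      (h.tendsto_measure_compl hA htpos ht) (fun _ => zero_le) fun k => measure_mono ?_
    intro w hw
    by_contra hcon
    have hcon' : w ∉ {w : E n | x + t k • w ∉ A} := hcon
    simp only [Set.mem_ofPred_eq, Set.indicator_of_notMem hcon', edist_self] at hw
    exact hε.not_ge hw
  obtain ⟨ns, hns, hlim⟩ := key.exists_seq_tendsto_ae
  refine ⟨ns, hns, hlim.mono fun w hw => ?_⟩
  filter_upwards [hw.eventually_lt_const (show (0 : ℝ) < 1 by norm_num)] with k hk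
  by_contra hcon
  rw [Set.indicator_of_mem (s := {w : E n | x + t (ns k) • w ∉ A}) hcon] at hk
  exact lt_irrefl _ hk

/-- Almost every ray is eventually in the density-one set along the subsequence, and there the
first-order error is o(t|w|). -/
theorem HasApproxDiffAt.exists_seq {F : E n → AQ Q m} {x : E n} {P : Fin Q → E m}
    {L : Fin Q → E n →L[ℝ] E m} (h : HasApproxDiffAt F x P L) {t : ℕ → ℝ} (htpos : ∀ k, 0 < t k)
    (ht : Tendsto t atTop (𝓝 0)) : ∃ ns : ℕ → ℕ, StrictMono ns ∧ ∀ᵐ w ∂ballMeas n,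
      Tendsto (fun k => gDist (F (x + t (ns k) • w))
        (ofTuple fun i => P i + L i (t (ns k) • w)) / t (ns k)) atTop (𝓝 0) := by
  obtain ⟨-, ⟨A, hA, -, hd, ho⟩, -⟩ := h
  obtain ⟨ns, hns, hae⟩ := hd.exists_seq hA htpos ht
  refine ⟨ns, hns, hae.mono fun w hw => ?_⟩
  have hlim : Tendsto (fun k => x + t (ns k) • w) atTop (𝓝[A] x) := by
    refine tendsto_nhdsWithin_iff.2 ⟨?_, hw⟩
    simpa using ((ht.comp hns.tendsto_atTop).smul_const w).const_add x
  have h1 := ho.comp_tendsto hlim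
  have h2 : ((fun y => y - x) ∘ fun k => x + t (ns k) • w) =O[atTop] fun k => t (ns k) := by
    refine IsBigO.of_bound ‖w‖ (Eventually.of_forall fun k => ?_)
    simp [norm_smul, mul_comm]
  have h3 := (h1.trans_isBigO h2).tendsto_div_nhds_zero
  simpa [Function.comp_def] using h3

theorem ae_ae_translate {p : E n → Prop} (hp : ∀ᵐ y, p y) (t : ℝ) :
    ∀ᵐ x, ∀ᵐ w ∂ballMeas n, p (x + t • w) := by
  have h1 := (quasiMeasurePreserving_shear (ballMeas n) (c := fun w => t • w) (by fun_prop)).comp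
    (Measure.measurePreserving_swap (μ := (volume : Measure (E n)))
      (ν := ballMeas n)).quasiMeasurePreserving
  exact Measure.ae_ae_of_ae_prod (h1.ae hp)

theorem ae_ae_integrable_seg {F : Type*} [NormedAddCommGroup F] [NormedSpace ℝ F] {g : E n → F}
    (hm : StronglyMeasurable g) (hg : Integrable g) (t : ℝ) :
    ∀ᵐ x, ∀ᵐ w ∂ballMeas n, Integrable (fun s : ℝ => g (x + s • t • w)) unitMeas := by
  refine (Measure.ae_ae_comm ?_).2 (ae_of_all _ fun w => ae_integrable_seg hg (t • w))
  exact measurableSet_integrable (μ := unitMeas) (f := fun (p : E n × E n) (s : ℝ) =>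
    g (p.1 + s • t • p.2)) (hm.comp_measurable (by fun_prop))

/-- For fixed w the increment formula holds for almost every x; the blow-up fixes x and varies w.
Exchanging the quantifiers requires measurability of the set of good pairs, which is why h and v are
measurable on the whole space. Only then is h replaced by the possibly non-measurable representative
G at both endpoints. -/
theorem HasWeakGrad.ae_ae_sub_eq {h G : E n → ℝ} {v : E n → E n}
    (H : HasWeakGrad (Metric.ball 0 1) h v) (hG : ∀ᵐ y ∂ballMeas n, h y = G y) {t : ℝ}
    (ht : 0 < t) : ∀ᵐ x, ∀ᵐ w ∂ballMeas n, ‖x‖ < 1 - t →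
      G (x + t • w) - G x = t * inner ℝ w (segAvg v (t • w) x) := by
  have h1 : ∀ᵐ x, ∀ᵐ w ∂ballMeas n, x ∈ Metric.ball (0 : E n) (1 - t) →
      h (x + t • w) - h x = inner ℝ (t • w) (segAvg v (t • w) x) := by
    refine (Measure.ae_ae_comm ?_).2
      ((ae_restrict_mem measurableSet_ball).mono fun w hw => ?_)
    · have m1 : Measurable fun p : E n × E n => h (p.1 + t • p.2) - h p.1 :=
        (H.meas.measurable.comp (by fun_prop)).sub (H.meas.measurable.comp (by fun_prop))
      have m2 : Measurable fun p : E n × E n =>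
          inner ℝ (t • p.2) (segAvg v (t • p.2) p.1) := by
        refine Measurable.inner (by fun_prop) ?_
        exact ((stronglyMeasurable_segAvg H.meas_grad).comp_measurable
          (g := fun p : E n × E n => (t • p.2, p.1)) (by fun_prop)).measurable
      exact (measurable_fst measurableSet_ball).imp (measurableSet_eq_fun m1 m2)
    · refine H.ae_sub_eq Metric.isOpen_ball (t • w) fun x hx s hs => ?_
      rw [mem_ball_zero_iff] at hx hw ⊢
      have : ‖s • t • w‖ ≤ t := by
        rw [norm_smul, norm_smul, Real.norm_of_nonneg hs.1, Real.norm_of_nonneg ht.le]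
        calc s * (t * ‖w‖) ≤ 1 * (t * 1) := by
              gcongr
              exact hs.2
          _ = t := by ring
      linarith [norm_add_le x (s • t • w)]
  have hG' := (ae_restrict_iff' measurableSet_ball).1 hG
  filter_upwards [h1, ae_ae_translate hG' t, hG'] with x h1 h2 h3
  filter_upwards [h1, h2, ae_restrict_mem measurableSet_ball] with w h1 h2 hw hx
  rw [mem_ball_zero_iff] at hw
  have e1 := h1 (by simpa using hx)
  rw [h2, h3, inner_smul_left] at e1
  · simpa using e1
  · rw [mem_ball_zero_iff]
    linarith
  · rw [mem_ball_zero_iff]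
    have : ‖t • w‖ ≤ t := by
      rw [norm_smul, Real.norm_of_nonneg ht.le]
      exact mul_le_of_le_one_right ht.le hw.le
    linarith [norm_add_le x (t • w)]

/-- Upgrades closed conditions from almost every direction to every direction in the ball. -/
theorem ball_subset_of_ae_mem {S : Set (E n)} (hS : IsClosed S) (h : ∀ᵐ w ∂ballMeas n, w ∈ S) :
    Metric.ball 0 1 ⊆ S := by
  have h1 : volume (Sᶜ ∩ Metric.ball (0 : E n) 1) = 0 := by
    rw [← Measure.restrict_apply' measurableSet_ball]
    exact h
  have h2 := (hS.isOpen_compl.inter Metric.isOpen_ball).eq_empty_of_measure_zero h1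
  intro w hw
  by_contra hcon
  exact (Set.mem_empty_iff_false w).1 (h2 ▸ ⟨hcon, hw⟩)

/-- Along x + t w the map F agrees with its first-order expansion up to o(t). For small t the
displacement L j (t w) is below half the gap from P j to the other values, so `norm_le_gDist_add`
makes t‖L j w‖ at most t·a + o(t). -/
theorem norm_le_of_gDist_bound {F : E n → AQ Q m} {x w : E n} {P : Fin Q → E m}
    {L : Fin Q → E n →L[ℝ] E m} (hx : F x = ofTuple P) {t a : ℕ → ℝ} {c : ℝ}
    (htpos : ∀ k, 0 < t k) (ht : Tendsto t atTop (𝓝 0))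
    (hd : Tendsto (fun k => gDist (F (x + t k • w))
      (ofTuple fun i => P i + L i (t k • w)) / t k) atTop (𝓝 0))
    (ha : Tendsto a atTop (𝓝 c))
    (hb : ∀ᶠ k in atTop, gDist (F (x + t k • w)) (F x) ≤ t k * a k) (j : Fin Q) :
    ‖L j w‖ ≤ c := by
  have hsmall : ∀ᶠ k in atTop, ∀ i, P i ≠ P j → 2 * ‖L j (t k • w)‖ ≤ ‖P i - P j‖ := by
    refine eventually_all.2 fun i => ?_
    by_cases hij : P i = P j
    · exact Eventually.of_forall fun k h => absurd hij h
    have hlim : Tendsto (fun k => 2 * ‖L j (t k • w)‖) atTop (𝓝 0) := by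
      have h1 : Tendsto (fun k => t k • w) atTop (𝓝 0) := by simpa using ht.smul_const w
      have h2 := (((L j).continuous.tendsto 0).comp h1).norm.const_mul 2
      simpa using h2
    filter_upwards [hlim.eventually_lt_const (norm_pos_iff.2 (sub_ne_zero.2 hij))] with k hk _
    exact hk.le
  have hle : ∀ᶠ k in atTop, ‖L j w‖ ≤ a k + gDist (F (x + t k • w))
      (ofTuple fun i => P i + L i (t k • w)) / t k := by
    filter_upwards [hsmall, hb] with k hk hbk
    have h1 := norm_le_gDist_add P (fun i => L i (t k • w)) j hk
    have h2 := gDist_triangle (F x) (F (x + t k • w)) (ofTuple fun i => P i + L i (t k • w))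
    rw [gDist_comm (F x) (F (x + t k • w))] at h2
    rw [← hx, map_smul, norm_smul, Real.norm_of_nonneg (htpos k).le] at h1
    have h3 : t k * ‖L j w‖ ≤ t k * a k + gDist (F (x + t k • w))
      (ofTuple fun i => P i + L i (t k • w)) := by linarith
    have h4 := htpos k
    rw [← mul_le_mul_iff_right₀ h4, mul_add, mul_div_cancel₀ _ h4.ne']
    exact h3
  have := ha.add hd
  rw [add_zero] at this
  exact ge_of_tendsto this hle

/-- With N the distance from the first-order expansion to Q⟦0⟧ and g that from F x, the limit of (N²
- g²)/t is computed twice: from the increments of 𝒢(F, Q⟦0⟧), and by expanding the squares. Using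
squares avoids any case distinction at g = 0. -/
theorem sum_inner_eq_of_gDist_quotient {F : E n → AQ Q m} {x w : E n} {P : Fin Q → E m}
    {L : Fin Q → E n →L[ℝ] E m} (hx : F x = ofTuple P) {t a : ℕ → ℝ} {c : ℝ}
    (htpos : ∀ k, 0 < t k) (ht : Tendsto t atTop (𝓝 0))
    (hd : Tendsto (fun k => gDist (F (x + t k • w))
      (ofTuple fun i => P i + L i (t k • w)) / t k) atTop (𝓝 0))
    (ha : Tendsto a atTop (𝓝 c))
    (hb : ∀ᶠ k in atTop, gDist (F (x + t k • w)) (zeroPt Q m) - gDist (F x) (zeroPt Q m) =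
      t k * a k) :
    ∑ i, inner ℝ (P i) (L i w) = gDist (F x) (zeroPt Q m) * c := by
  set G : ℕ → ℝ := fun k => gDist (F (x + t k • w)) (zeroPt Q m) with hG
  set N : ℕ → ℝ := fun k => gDist (ofTuple fun i => P i + L i (t k • w)) (zeroPt Q m) with hN
  set g : ℝ := gDist (F x) (zeroPt Q m) with hg
  have hGlim : Tendsto G atTop (𝓝 g) := by
    have h1 := (ht.mul ha).const_add g
    rw [zero_mul, add_zero] at h1
    refine h1.congr' (hb.mono fun k hk => ?_)
    linarith
  have hGN : Tendsto (fun k => (G k - N k) / t k) atTop (𝓝 0) := by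
    refine squeeze_zero_norm (fun k => ?_) hd
    rw [norm_div, Real.norm_of_nonneg (htpos k).le]
    have := htpos k
    gcongr
    exact abs_gDist_sub_le _ _ _
  have hGN' : Tendsto (fun k => G k - N k) atTop (𝓝 0) := by
    have h1 := hGN.mul ht
    rw [mul_zero] at h1
    exact h1.congr fun k => div_mul_cancel₀ _ (htpos k).ne'
  have hNlim : Tendsto N atTop (𝓝 g) := by
    have := hGlim.sub hGN'
    simpa using this
  have l1 : Tendsto (fun k => (N k ^ 2 - g ^ 2) / t k) atTop (𝓝 (2 * (g * c))) := by
    have h1 := ((hGlim.add_const g).mul ha).sub (hGN.mul (hGlim.add hNlim))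
    rw [zero_mul, sub_zero, ← two_mul, mul_assoc] at h1
    refine h1.congr' (hb.mono fun k hk => ?_)
    have h2 := (htpos k).ne'
    have h3 : a k = (G k - g) / t k := by
      rw [hk]
      field_simp
    rw [h3]
    field_simp
    ring
  have l2 : Tendsto (fun k => (N k ^ 2 - g ^ 2) / t k) atTop
      (𝓝 (2 * ∑ i, inner ℝ (P i) (L i w))) := by
    have h1 := (ht.mul_const (∑ i, ‖L i w‖ ^ 2)).const_add (2 * ∑ i, inner ℝ (P i) (L i w))
    rw [zero_mul, add_zero] at h1
    refine h1.congr fun k => ?_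
    have h2 := (htpos k).ne'
    rw [hN, hg, hx, gDist_zeroPt_sq, gDist_zeroPt_sq, ← Finset.sum_sub_distrib, eq_div_iff h2]
    rw [Finset.mul_sum, Finset.mul_sum, ← Finset.sum_add_distrib, Finset.sum_mul]
    refine Finset.sum_congr rfl fun i _ => ?_
    rw [norm_add_sq_real, map_smul, inner_smul_right, norm_smul, mul_pow, Real.norm_eq_abs, sq_abs]
    ring
  have := tendsto_nhds_unique l1 l2
  linarith

end BlowUp

/-! ### From the metric definition of W^{1,2} to differentials in L² -/

section ChainRule

variable {n m Q : ℕ}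

theorem norm_basisVec (j : Fin n) : ‖basisVec j‖ = 1 := by simp [basisVec]

theorem sum_smul_basisVec (z : E n) : ∑ j, z j • basisVec j = z := by
  ext i
  simp [basisVec, Finset.sum_apply, Pi.single_apply]

theorem inner_basisVec (z : E n) (j : Fin n) : inner ℝ z (basisVec j) = z j := by
  simp [basisVec, EuclideanSpace.inner_single_right]

theorem map_eq_sum_basisVec {G : Type*} [NormedAddCommGroup G] [NormedSpace ℝ G]
    (A : E n →L[ℝ] G) (z : E n) : A z = ∑ j, z j • A (basisVec j) := by
  conv_lhs => rw [← sum_smul_basisVec z, map_sum]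
  simp

theorem memLp_indicator_ball {G : Type*} [NormedAddCommGroup G] {g : E n → G}
    (hg : MemLp g 2 (ballMeas n)) : MemLp ((Metric.ball 0 1).indicator g) 2 volume :=
  (memLp_indicator_iff_restrict measurableSet_ball).2 hg

theorem integrable_indicator_ball {G : Type*} [NormedAddCommGroup G] {g : E n → G}
    (hg : MemLp g 2 (ballMeas n)) : Integrable ((Metric.ball 0 1).indicator g) volume :=
  (integrable_indicator_iff measurableSet_ball).2 (hg.integrable (by norm_num))

/-- For `F ∈ W^{1,2}`, the functions `gDist (F ·) T` have measurable representatives with weak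
gradients that are bounded by one square integrable function, for all `T`. -/
theorem MemW12.exists_hasWeakGrad {F : E n → AQ Q m} (hF : MemW12 (Metric.ball 0 1) F) :
    ∃ Φ : E n → ℝ, StronglyMeasurable Φ ∧ Integrable Φ ∧ MemLp Φ 2 volume ∧
      ∀ T : AQ Q m, ∃ (h : E n → ℝ) (v : E n → E n), HasWeakGrad (Metric.ball 0 1) h v ∧
        (∀ᵐ y ∂ballMeas n, h y = gDist (F y) T) ∧ ∀ x, ‖v x‖ ≤ Φ x := by
  obtain ⟨φ, hφ, hT⟩ := hF
  set B : Set (E n) := Metric.ball 0 1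
  have hB : MeasurableSet B := measurableSet_ball
  let φ' : Fin n → E n → ℝ := fun j => (hφ j).1.1.mk (φ j)
  have hφ' : ∀ j, StronglyMeasurable (φ' j) := fun j => (hφ j).1.1.stronglyMeasurable_mk
  have hφe : ∀ j, φ j =ᵐ[ballMeas n] φ' j := fun j => (hφ j).1.1.ae_eq_mk
  have hφm : ∀ j, MemLp (φ' j) 2 (ballMeas n) := fun j => (memLp_congr_ae (hφe j)).1 (hφ j).1
  have hsum : MemLp (fun x => ∑ j, |φ' j x|) 2 (ballMeas n) :=
    memLp_finsetSum _ fun j _ => (hφm j).abs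
  refine ⟨B.indicator fun x => ∑ j, |φ' j x|, ?_, integrable_indicator_ball hsum,
    memLp_indicator_ball hsum, fun T => ?_⟩
  · refine StronglyMeasurable.indicator ?_ hB
    exact Finset.stronglyMeasurable_fun_sum _ fun j _ => (hφ' j).norm
  obtain ⟨hT1, hT2⟩ := hT T
  choose v hv hw hle using hT2
  let v' : Fin n → E n → ℝ := fun j => (hv j).1.mk (v j)
  -- Truncation at ±|φ'| changes the weak derivative only on a null set and makes the bound valid at
  -- every point, so that it passes to segment averages without exceptional sets.
  let u : Fin n → E n → ℝ := fun j x => max (-|φ' j x|) (min |φ' j x| (v' j x))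
  have hum : ∀ j, StronglyMeasurable (u j) := fun j =>
    (hφ' j).norm.neg.sup ((hφ' j).norm.inf (hv j).1.stronglyMeasurable_mk)
  have hua : ∀ j x, |u j x| ≤ |φ' j x| := fun j x =>
    abs_le.2 ⟨le_max_left _ _, max_le (by linarith [abs_nonneg (φ' j x)]) (min_le_left _ _)⟩
  have hue : ∀ j, u j =ᵐ[ballMeas n] v j := fun j => by
    filter_upwards [hφe j, (hv j).1.ae_eq_mk, hle j] with x h1 h2 h3
    have h4 : |v' j x| ≤ |φ' j x| := by
      change |(hv j).1.mk (v j) x| ≤ |φ' j x|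
      rw [← h2, ← h1]
      exact h3.trans (le_abs_self _)
    change max _ (min _ (v' j x)) = _
    rw [min_eq_right (abs_le.1 h4).2, max_eq_right (abs_le.1 h4).1]
    exact h2.symm
  have hu2 : ∀ j, MemLp (u j) 2 (ballMeas n) := fun j => (memLp_congr_ae (hue j)).2 (hv j)
  have hV2 : MemLp (fun x => ∑ j, u j x • basisVec j) 2 (ballMeas n) :=
    memLp_finsetSum _ fun j _ => (hu2 j).of_le
      ((hu2 j).1.smul_const (basisVec j)) (ae_of_all _ fun x => by simp [norm_smul, norm_basisVec])
  have hVm : StronglyMeasurable fun x => ∑ j, u j x • (basisVec j : E n) :=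
    Finset.stronglyMeasurable_fun_sum _ fun j _ => (hum j).smul_const _
  have hhe := hT1.1.ae_eq_mk
  have hh2 : MemLp (hT1.1.mk _) 2 (ballMeas n) := (memLp_congr_ae hhe).1 hT1
  refine ⟨B.indicator (hT1.1.mk _), B.indicator fun x => ∑ j, u j x • basisVec j,
    ⟨hT1.1.stronglyMeasurable_mk.indicator hB, hVm.indicator hB, integrable_indicator_ball hh2,
      integrable_indicator_ball hV2, memLp_indicator_ball hh2, memLp_indicator_ball hV2, ?_⟩,
      ?_, fun x => ?_⟩
  · intro ζ hζ hc hs z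
    have hcont := hζ.continuous
    have hcf := hζ.continuous_fderiv (by simp)
    obtain ⟨C, hC⟩ := exists_norm_fderiv_le hζ hc
    obtain ⟨C', hC'⟩ := hcont.bounded_above_of_compact_support hc
    have e1 : ∫ x, B.indicator (hT1.1.mk _) x * fderiv ℝ ζ x z =
        ∫ x in B, gDist (F x) T * fderiv ℝ ζ x z := by
      rw [← integral_indicator hB]
      have h1 := (ae_restrict_iff' hB).1 hhe
      refine integral_congr_ae ?_
      filter_upwards [h1] with x hx
      by_cases hxB : x ∈ B
      · simp only [Set.indicator_of_mem hxB]
        rw [← hx hxB]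
      · simp [Set.indicator_of_notMem hxB]
    have e2 : ∫ x, inner ℝ z (B.indicator (fun x => ∑ j, u j x • basisVec j) x) * ζ x =
        ∫ x in B, ∑ j, z j * (v j x * ζ x) := by
      rw [← integral_indicator hB]
      have h1 := (ae_restrict_iff' hB).1 (ae_all_iff.2 hue)
      refine integral_congr_ae ?_
      filter_upwards [h1] with x hx
      by_cases hxB : x ∈ B
      · simp only [Set.indicator_of_mem hxB, inner_sum, inner_smul_right, inner_basisVec,
          Finset.sum_mul, hx hxB]
        exact Finset.sum_congr rfl fun j _ => by ring
      · simp [Set.indicator_of_notMem hxB]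
    have e3 : ∀ x, gDist (F x) T * fderiv ℝ ζ x z =
        ∑ j, z j * (gDist (F x) T * fderiv ℝ ζ x (basisVec j)) := fun x => by
      rw [map_eq_sum_basisVec, Finset.mul_sum]
      exact Finset.sum_congr rfl fun j _ => by rw [smul_eq_mul]; ring
    rw [e1, e2]
    simp_rw [e3]
    rw [integral_finsetSum, integral_finsetSum, ← Finset.sum_neg_distrib]
    · refine Finset.sum_congr rfl fun j _ => ?_
      rw [integral_const_mul, integral_const_mul, hw j ζ hζ hc hs, mul_neg]
    · intro j _
      refine ((((hv j).integrable (by norm_num)).mul_bdd (c := C') ?_ ?_)).const_mul _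
      · exact hcont.aestronglyMeasurable
      · exact ae_of_all _ hC'
    · intro j _
      refine (((hT1.integrable (by norm_num)).mul_bdd (c := C) ?_ ?_)).const_mul _
      · exact Continuous.aestronglyMeasurable (by fun_prop)
      · refine ae_of_all _ fun x => ((fderiv ℝ ζ x).le_opNorm _).trans ?_
        rw [norm_basisVec, mul_one]
        exact hC x
  · filter_upwards [hhe, ae_restrict_mem hB] with x hx hxB
    rw [Set.indicator_of_mem hxB, ← hx]
  · by_cases hxB : x ∈ B
    · simp only [Set.indicator_of_mem hxB]
      refine (norm_sum_le _ _).trans (Finset.sum_le_sum fun j _ => ?_)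
      rw [norm_smul, norm_basisVec, mul_one]
      exact hua j x
    · simp [Set.indicator_of_notMem hxB]

theorem norm_segAvg_le {v : E n → E n} {Φ : E n → ℝ} (h : ∀ x, ‖v x‖ ≤ Φ x) {z x : E n}
    (hi : Integrable (fun s : ℝ => Φ (x + s • z)) unitMeas) :
    ‖segAvg v z x‖ ≤ segAvg Φ z x :=
  norm_integral_le_of_norm_le hi (ae_of_all _ fun _ => h _)

/-- A point T k close to U makes the difference of distances almost equal to 𝒢(S, U). Countably many
scalar functions therefore control the metric increment. -/
theorem gDist_le_of_forall_dense {T : ℕ → AQ Q m}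
    (hT : ∀ S, ∀ δ > 0, ∃ k, gDist S (T k) < δ) {S U : AQ Q m} {c : ℝ}
    (h : ∀ k, |gDist S (T k) - gDist U (T k)| ≤ c) : gDist S U ≤ c := by
  refine le_of_forall_pos_le_add fun δ hδ => ?_
  obtain ⟨k, hk⟩ := hT U (δ / 2) (half_pos hδ)
  have h1 := gDist_triangle S (T k) U
  have h2 := (abs_le.1 (h k)).2
  rw [gDist_comm (T k) U] at h1
  linarith

/-- The approximate differentials of a `W^{1,2}` map are bounded by the function that bounds all
weak gradients. -/
theorem ae_norm_approxDiff_le {F : E n → AQ Q m} {f : Fin Q → E n → E m}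
    {Df : Fin Q → E n → E n →L[ℝ] E m} (hsel : IsSelection (Metric.ball 0 1) F f Df)
    {Φ : E n → ℝ} (hΦm : StronglyMeasurable Φ) (hΦi : Integrable Φ) (hΦ2 : MemLp Φ 2 volume)
    (hΦ : ∀ T : AQ Q m, ∃ (h : E n → ℝ) (v : E n → E n), HasWeakGrad (Metric.ball 0 1) h v ∧
        (∀ᵐ y ∂ballMeas n, h y = gDist (F y) T) ∧ ∀ x, ‖v x‖ ≤ Φ x) :
    ∀ᵐ x ∂ballMeas n, ∀ j, ‖Df j x‖ ≤ Φ x := by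
  obtain ⟨T, hT⟩ := exists_countable_gDist_dense Q m
  choose h v hH hG hv using fun i => hΦ (T i)
  set t : ℕ → ℝ := fun k => 1 / ((k : ℝ) + 1)
  have htpos : ∀ k, 0 < t k := fun k => by positivity
  have ht : Tendsto t atTop (𝓝 0) := tendsto_one_div_add_atTop_nhds_zero_nat
  obtain ⟨ns, hns, hlim⟩ := exists_seq_tendsto_segAvg hΦm hΦi hΦ2 ht
  have a1 := ae_all_iff.2 fun i => ae_all_iff.2 fun k => (hH i).ae_ae_sub_eq (hG i) (htpos k)
  have a2 := ae_all_iff.2 fun k => ae_ae_integrable_seg hΦm hΦi (t k)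
  filter_upwards [ae_restrict_of_ae hlim, ae_restrict_of_ae a1, ae_restrict_of_ae a2,
    hsel.approxDiff, ae_restrict_mem measurableSet_ball] with x hlim a1 a2 had hxB j
  obtain ⟨ns', hns', hd⟩ := had.exists_seq (t := fun k => t (ns k)) (fun k => htpos _)
    (ht.comp hns.tendsto_atTop)
  have hsub : Tendsto (fun k => ns (ns' k)) atTop atTop :=
    hns.tendsto_atTop.comp hns'.tendsto_atTop
  have hΦ0 : 0 ≤ Φ x := (norm_nonneg _).trans (hv 0 x)
  -- Every function 𝒢(F, T i) changes between x and x + tw by at most t‖w‖ times the average of the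
  -- common bound Φ; hence so does F in the metric 𝒢, and the blow-up yields the bound on Df.
  have key : ∀ᵐ w ∂ballMeas n, w ∈ {w | ‖Df j x w‖ ≤ ‖w‖ * Φ x} := by
    have a1' : ∀ᵐ w ∂ballMeas n, ∀ i k, ‖x‖ < 1 - t k → gDist (F (x + t k • w)) (T i) -
        gDist (F x) (T i) = t k * inner ℝ w (segAvg (v i) (t k • w) x) :=
      ae_all_iff.2 fun i => ae_all_iff.2 fun k => a1 i k
    filter_upwards [hlim, a1', ae_all_iff.2 a2, hd] with w hlim a1 a2 hd
    refine norm_le_of_gDist_bound had.1 (t := fun k => t (ns (ns' k)))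
      (a := fun k => ‖w‖ * segAvg Φ (t (ns (ns' k)) • w) x) (fun k => htpos _) (ht.comp hsub) hd
      ((hlim.comp hns'.tendsto_atTop).const_mul _) ?_ j
    have hlt : ∀ᶠ k in atTop, t (ns (ns' k)) < 1 - ‖x‖ :=
      (ht.comp hsub).eventually_lt_const (by rw [mem_ball_zero_iff] at hxB; linarith)
    filter_upwards [hlt] with k hk
    refine gDist_le_of_forall_dense hT fun i => ?_
    rw [a1 i _ (by linarith), abs_mul, abs_of_pos (htpos _)]
    refine mul_le_mul_of_nonneg_left ?_ (htpos _).le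
    refine (abs_real_inner_le_norm _ _).trans ?_
    exact mul_le_mul_of_nonneg_left (norm_segAvg_le (hv i) (a2 _)) (norm_nonneg _)
  have hclosed : IsClosed {w | ‖Df j x w‖ ≤ ‖w‖ * Φ x} :=
    isClosed_le (by fun_prop) (by fun_prop)
  have hball := ball_subset_of_ae_mem hclosed key
  -- By homogeneity the bound on the unit ball, used on the shell 1/2 ≤ ‖w‖ < 1, determines the
  -- operator norm.
  refine ContinuousLinearMap.opNorm_le_of_shell (ε := 1) one_pos hΦ0 (c := (2 : ℝ)) (by simp)
    fun w _ hw => ?_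
  rw [mul_comm]
  exact hball (mem_ball_zero_iff.2 hw)

/-- The weak gradient of `|F|` pairs with `|F|` as `∑ᵢ ⟨fᵢ, Dfᵢ ·⟩`. -/
theorem ae_sum_inner_eq {F : E n → AQ Q m} {f : Fin Q → E n → E m}
    {Df : Fin Q → E n → E n →L[ℝ] E m} (hsel : IsSelection (Metric.ball 0 1) F f Df)
    {h : E n → ℝ} {v : E n → E n} (H : HasWeakGrad (Metric.ball 0 1) h v)
    (hG : ∀ᵐ y ∂ballMeas n, h y = gDist (F y) (zeroPt Q m)) :
    ∀ᵐ x ∂ballMeas n, ∀ z, ∑ i, inner ℝ (f i x) (Df i x z) = h x * inner ℝ z (v x) := by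
  set t : ℕ → ℝ := fun k => 1 / ((k : ℝ) + 1)
  have htpos : ∀ k, 0 < t k := fun k => by positivity
  have ht : Tendsto t atTop (𝓝 0) := tendsto_one_div_add_atTop_nhds_zero_nat
  obtain ⟨ns, hns, hlim⟩ := exists_seq_tendsto_segAvg H.meas_grad H.int_grad H.memLp_grad ht
  have a1 := ae_all_iff.2 fun k => H.ae_ae_sub_eq hG (htpos k)
  filter_upwards [ae_restrict_of_ae hlim, ae_restrict_of_ae a1, hG,
    hsel.approxDiff, ae_restrict_mem measurableSet_ball] with x hlim a1 hGx had hxB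
  obtain ⟨ns', hns', hd⟩ := had.exists_seq (t := fun k => t (ns k)) (fun k => htpos _)
    (ht.comp hns.tendsto_atTop)
  have hsub : Tendsto (fun k => ns (ns' k)) atTop atTop :=
    hns.tendsto_atTop.comp hns'.tendsto_atTop
  set S : Set (E n) := {w | ∑ i, inner ℝ (f i x) (Df i x w) = h x * inner ℝ w (v x)}
  have key : ∀ᵐ w ∂ballMeas n, w ∈ S := by
    filter_upwards [hlim, ae_all_iff.2 a1, hd] with w hlim a1 hd
    change _ = _
    rw [hGx]
    refine sum_inner_eq_of_gDist_quotient had.1 (t := fun k => t (ns (ns' k)))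
      (a := fun k => inner ℝ w (segAvg v (t (ns (ns' k)) • w) x)) (fun k => htpos _)
      (ht.comp hsub) hd (tendsto_const_nhds.inner (hlim.comp hns'.tendsto_atTop)) ?_
    have hlt : ∀ᶠ k in atTop, t (ns (ns' k)) < 1 - ‖x‖ :=
      (ht.comp hsub).eventually_lt_const (by rw [mem_ball_zero_iff] at hxB; linarith)
    filter_upwards [hlt] with k hk
    exact a1 _ (by linarith)
  have hclosed : IsClosed S := isClosed_eq (by fun_prop) (by fun_prop)
  have hball := ball_subset_of_ae_mem hclosed key
  intro z
  set c : ℝ := (‖z‖ + 1)⁻¹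
  have hc : 0 < c := by positivity
  have hz : c • z ∈ Metric.ball (0 : E n) 1 := by
    rw [mem_ball_zero_iff, norm_smul, Real.norm_of_nonneg hc.le, inv_mul_lt_one₀ (by positivity)]
    linarith
  have h1 : _ = _ := hball hz
  simp only [map_smul, inner_smul_right, inner_smul_left, ← Finset.mul_sum, conj_trivial] at h1
  apply mul_left_cancel₀ hc.ne'
  rw [h1]
  ring

/-- Square integrability of a selection and of its differentials, and the weak gradient of
`∑ᵢ |fᵢ|²`. -/
structure IsSobolevSelection (f : Fin Q → E n → E m) (Df : Fin Q → E n → E n →L[ℝ] E m) :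
    Prop where
  memLp : ∀ i, MemLp (f i) 2 (ballMeas n)
  memLp_diff : ∀ i, MemLp (Df i) 2 (ballMeas n)
  weak : ∀ ζ : E n → ℝ, ContDiff ℝ ∞ ζ → HasCompactSupport ζ → tsupport ζ ⊆ Metric.ball 0 1 →
    ∀ z, ∫ x, (∑ i, ‖f i x‖ ^ 2) * fderiv ℝ ζ x z ∂ballMeas n =
      - ∫ x, 2 * (∑ i, inner ℝ (f i x) (Df i x z)) * ζ x ∂ballMeas n

/-- Collects all that the variational part needs from the Sobolev hypothesis: fᵢ is bounded by h =
|F| and Dfᵢ by Φ, both in L², and the square rule for h² combines with h∇h = ∑⟨fᵢ, Dfᵢ⟩. -/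
theorem isSobolevSelection {F : E n → AQ Q m} {f : Fin Q → E n → E m}
    {Df : Fin Q → E n → E n →L[ℝ] E m} (hF : MemW12 (Metric.ball 0 1) F)
    (hsel : IsSelection (Metric.ball 0 1) F f Df) : IsSobolevSelection f Df := by
  obtain ⟨Φ, hΦm, hΦi, hΦ2, hΦ⟩ := hF.exists_hasWeakGrad
  obtain ⟨h, v, H, hG, -⟩ := hΦ (zeroPt Q m)
  have hbd := ae_norm_approxDiff_le hsel hΦm hΦi hΦ2 hΦ
  have hin := ae_sum_inner_eq hsel H hG
  have hsq : ∀ᵐ x ∂ballMeas n, h x ^ 2 = ∑ i, ‖f i x‖ ^ 2 := by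
    filter_upwards [hG, hsel.approxDiff] with x h1 h2
    rw [h1, h2.1, gDist_zeroPt_sq]
  refine ⟨fun i => ?_, fun i => ?_, fun ζ hζ hc hs z => ?_⟩
  · refine (H.memLp.restrict _).of_le (hsel.meas i) ?_
    filter_upwards [hsq] with x hx
    rw [← abs_norm, Real.norm_eq_abs, ← sq_le_sq, hx]
    exact Finset.single_le_sum (f := fun i => ‖f i x‖ ^ 2) (fun _ _ => sq_nonneg _)
      (Finset.mem_univ i)
  · refine (hΦ2.restrict _).of_le (hsel.meas_diff i) ?_
    filter_upwards [hbd] with x hx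
    exact (hx i).trans (le_abs_self _)
  · have key := H.integral_sq_mul_fderiv Metric.isOpen_ball hζ hc hs z
    have hz : ∀ x, x ∉ Metric.ball (0 : E n) 1 → x ∉ tsupport ζ := fun x hx hx' => hx (hs hx')
    have hz' : ∀ x, x ∉ Metric.ball (0 : E n) 1 → fderiv ℝ ζ x = 0 := fun x hx => by
      by_contra hcon
      exact hz x hx (tsupport_fderiv_subset ℝ (subset_tsupport _ hcon))
    have e1 : ∫ x, (∑ i, ‖f i x‖ ^ 2) * fderiv ℝ ζ x z ∂ballMeas n =
        ∫ x, h x ^ 2 * fderiv ℝ ζ x z := by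
      rw [← setIntegral_eq_integral_of_forall_compl_eq_zero (s := Metric.ball (0 : E n) 1)
        (f := fun x => h x ^ 2 * fderiv ℝ ζ x z) fun x hx => by simp [hz' x hx]]
      refine integral_congr_ae ?_
      filter_upwards [hsq] with x hx
      rw [hx]
    have e2 : ∫ x, 2 * (∑ i, inner ℝ (f i x) (Df i x z)) * ζ x ∂ballMeas n =
        ∫ x, 2 * (h x * inner ℝ z (v x)) * ζ x := by
      rw [← setIntegral_eq_integral_of_forall_compl_eq_zero (s := Metric.ball (0 : E n) 1)
        (f := fun x => 2 * (h x * inner ℝ z (v x)) * ζ x) fun x hx => by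
          rw [image_eq_zero_of_notMem_tsupport (hz x hx), mul_zero]]
      refine integral_congr_ae ?_
      filter_upwards [hin] with x hx
      rw [hx]
    rw [e1, e2, key]

end ChainRule

/-! ### Cutoffs multiplied by powers of |x| -/

section Weights

variable {n m Q : ℕ}

/-- Smooth functions with compact support in the punctured unit ball. -/
structure IsCutoff (χ : E n → ℝ) : Prop where
  smooth : ContDiff ℝ ∞ χ
  compact : HasCompactSupport χ
  supp : tsupport χ ⊆ Metric.ball 0 1 \ {0}

/-- The power is singular only at the origin, near which g vanishes. -/
theorem contDiff_mul_norm_rpow {k : WithTop ℕ∞} {g : E n → ℝ} (hg : ContDiff ℝ k g)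
    (h0 : (0 : E n) ∉ tsupport g) (p : ℝ) : ContDiff ℝ k fun x => g x * ‖x‖ ^ p := by
  refine contDiff_iff_contDiffAt.2 fun x => ?_
  by_cases hx : x ∈ tsupport g
  · have hx0 : x ≠ 0 := fun h => h0 (h ▸ hx)
    exact hg.contDiffAt.mul
      ((contDiffAt_norm ℝ hx0).rpow_const_of_ne (norm_ne_zero_iff.2 hx0))
  · refine (contDiffAt_const (c := (0 : ℝ))).congr_of_eventuallyEq ?_
    filter_upwards [(isClosed_tsupport g).isOpen_compl.mem_nhds hx] with y hy
    rw [image_eq_zero_of_notMem_tsupport hy, zero_mul]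

theorem tsupport_mul_subset (g h : E n → ℝ) : tsupport (fun x => g x * h x) ⊆ tsupport g :=
  tsupport_mul_subset_left

theorem integrable_mul_norm_rpow_mul {g u : E n → ℝ} (hg : Continuous g)
    (hc : HasCompactSupport g) (h0 : (0 : E n) ∉ tsupport g) (p : ℝ)
    (hu : Integrable u (ballMeas n)) :
    Integrable (fun x => g x * ‖x‖ ^ p * u x) (ballMeas n) := by
  have hcont : Continuous fun x => g x * ‖x‖ ^ p :=
    (contDiff_mul_norm_rpow (contDiff_zero.2 hg) h0 p).continuous
  obtain ⟨C, hC⟩ := hcont.bounded_above_of_compact_support (hc.mul_right)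
  exact hu.bdd_mul hcont.aestronglyMeasurable (ae_of_all _ hC)

theorem hasFDerivAt_norm_rpow_of_ne {x : E n} (hx : x ≠ 0) (p : ℝ) :
    HasFDerivAt (fun y : E n => ‖y‖ ^ p) ((p * ‖x‖ ^ (p - 2)) • innerSL ℝ x) x := by
  have h1 := ((hasStrictFDerivAt_norm_sq x).hasFDerivAt).rpow_const (p := p / 2)
    (Or.inl (by positivity))
  have e : ∀ (y : E n) (q : ℝ), (‖y‖ ^ 2) ^ q = ‖y‖ ^ (2 * q) := fun y q => by
    rw [← Real.rpow_natCast, ← Real.rpow_mul (norm_nonneg _)]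
    norm_num
  simp only [e] at h1
  rw [show 2 * (p / 2) = p by ring, show 2 * (p / 2 - 1) = p - 2 by ring] at h1
  refine h1.congr_fderiv ?_
  rw [← Nat.cast_smul_eq_nsmul ℝ, smul_smul]
  congr 1
  push_cast
  ring

namespace IsCutoff

variable {χ : E n → ℝ}

theorem zero_notMem (hχ : IsCutoff χ) : (0 : E n) ∉ tsupport χ := fun h => (hχ.supp h).2 rfl

theorem apply_zero (hχ : IsCutoff χ) : χ 0 = 0 := image_eq_zero_of_notMem_tsupport hχ.zero_notMem

theorem zero_notMem_fderiv (hχ : IsCutoff χ) : (0 : E n) ∉ tsupport (fderiv ℝ χ) :=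
  fun h => hχ.zero_notMem (tsupport_fderiv_subset ℝ h)

theorem fderiv_zero (hχ : IsCutoff χ) : fderiv ℝ χ 0 = 0 :=
  image_eq_zero_of_notMem_tsupport hχ.zero_notMem_fderiv

theorem continuous_fderiv (hχ : IsCutoff χ) : Continuous (fderiv ℝ χ) :=
  hχ.smooth.continuous_fderiv (by simp)

theorem mul (hχ : IsCutoff χ) {g : E n → ℝ} (hg : ContDiff ℝ ∞ g) :
    IsCutoff fun x => χ x * g x :=
  ⟨hχ.smooth.mul hg, hχ.compact.mul_right, (tsupport_mul_subset χ g).trans hχ.supp⟩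

theorem weight (hχ : IsCutoff χ) (p : ℝ) : IsCutoff fun x => χ x * ‖x‖ ^ p :=
  ⟨contDiff_mul_norm_rpow hχ.smooth hχ.zero_notMem p, hχ.compact.mul_right,
    (tsupport_mul_subset χ _).trans hχ.supp⟩

theorem integrable (hχ : IsCutoff χ) (p : ℝ) {u : E n → ℝ} (hu : Integrable u (ballMeas n)) :
    Integrable (fun x => χ x * ‖x‖ ^ p * u x) (ballMeas n) :=
  integrable_mul_norm_rpow_mul hχ.smooth.continuous hχ.compact hχ.zero_notMem p hu

/-- Functions that depend continuously and pointwise linearly or sublinearly on `Dχ`. -/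
theorem integrable_of_fderiv (hχ : IsCutoff χ) (p : ℝ) {u g : E n → ℝ} (hg : Continuous g)
    (h : ∀ x, fderiv ℝ χ x = 0 → g x = 0) (hu : Integrable u (ballMeas n)) :
    Integrable (fun x => g x * ‖x‖ ^ p * u x) (ballMeas n) := by
  have hsub : Function.support g ⊆ Function.support (fderiv ℝ χ) := fun x hx h0 => hx (h x h0)
  exact integrable_mul_norm_rpow_mul hg ((hχ.compact.fderiv (𝕜 := ℝ)).mono hsub)
    (fun h0 => hχ.zero_notMem_fderiv (closure_mono hsub h0)) p hu

/-- At the origin both sides vanish because χ does, whatever value `0 ^ p` takes. -/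
theorem rpow_sub_two_mul (hχ : IsCutoff χ) (p : ℝ) (x : E n) :
    χ x * ‖x‖ ^ (p - 2) * ‖x‖ ^ 2 = χ x * ‖x‖ ^ p := by
  by_cases hx : x = 0
  · simp [hx, hχ.apply_zero]
  · rw [mul_assoc, ← Real.rpow_natCast, ← Real.rpow_add (norm_pos_iff.2 hx)]
    norm_num

theorem fderiv_weight (hχ : IsCutoff χ) (p : ℝ) (x z : E n) :
    fderiv ℝ (fun x => χ x * ‖x‖ ^ p) x z =
      fderiv ℝ χ x z * ‖x‖ ^ p + p * (χ x * ‖x‖ ^ (p - 2)) * inner ℝ x z := by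
  by_cases hx : x = 0
  · subst hx
    rw [(hχ.weight p).fderiv_zero, hχ.fderiv_zero, hχ.apply_zero]
    simp
  · have h1 := (hχ.smooth.differentiable (by simp) x).hasFDerivAt.mul
      (hasFDerivAt_norm_rpow_of_ne hx p)
    have h2 : fderiv ℝ (fun x => χ x * ‖x‖ ^ p) x = _ := h1.fderiv
    rw [h2]
    simp only [add_apply, smul_apply, smul_eq_mul, innerSL_apply_apply]
    ring

end IsCutoff

theorem IsCutoff.fderiv_weight_self {χ : E n → ℝ} (hχ : IsCutoff χ) (p : ℝ) (x : E n) :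
    fderiv ℝ (fun x => χ x * ‖x‖ ^ p) x x =
      fderiv ℝ χ x x * ‖x‖ ^ p + p * (χ x * ‖x‖ ^ p) := by
  rw [hχ.fderiv_weight, real_inner_self_eq_norm_sq, mul_assoc p, hχ.rpow_sub_two_mul]

end Weights

/-! ### The three integral identities -/

section Variations

variable {n m Q : ℕ}

theorem integrable_inner_of_memLp {a b : E n → E m} (ha : MemLp a 2 (ballMeas n))
    (hb : MemLp b 2 (ballMeas n)) : Integrable (fun x => inner ℝ (a x) (b x)) (ballMeas n) := by
  refine (ha.norm.integrable_mul hb.norm).mono' (ha.1.inner hb.1) (ae_of_all _ fun x => ?_)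
  exact norm_inner_le_norm _ _

namespace IsSobolevSelection

variable {f : Fin Q → E n → E m} {Df : Fin Q → E n → E n →L[ℝ] E m}

theorem memLp_apply (h : IsSobolevSelection f Df) (i : Fin Q) (z : E n) :
    MemLp (fun x => Df i x z) 2 (ballMeas n) :=
  (h.memLp_diff i).of_le_mul (c := ‖z‖) ((h.memLp_diff i).1.apply_continuousLinearMap z)
    (ae_of_all _ fun x => by rw [mul_comm]; exact (Df i x).le_opNorm z)

theorem memLp_radial (h : IsSobolevSelection f Df) (i : Fin Q) :
    MemLp (fun x => Df i x x) 2 (ballMeas n) := by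
  refine (h.memLp_diff i).of_le ?_ ?_
  · exact isBoundedBilinearMap_apply.continuous.comp_aestronglyMeasurable
      ((h.memLp_diff i).1.prodMk aestronglyMeasurable_id)
  · filter_upwards [ae_restrict_mem measurableSet_ball] with x hx
    rw [mem_ball_zero_iff] at hx
    exact ((Df i x).le_opNorm x).trans (mul_le_of_le_one_right (norm_nonneg _) hx.le)

theorem integrable_sq (h : IsSobolevSelection f Df) :
    Integrable (fun x => ∑ i, ‖f i x‖ ^ 2) (ballMeas n) :=
  integrable_finsetSum _ fun i _ => by
    simpa only [real_inner_self_eq_norm_sq] using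
      integrable_inner_of_memLp (h.memLp i) (h.memLp i)

theorem integrable_energy (h : IsSobolevSelection f Df) :
    Integrable (fun x => ∑ i, hsInner (Df i x) (Df i x)) (ballMeas n) :=
  integrable_finsetSum _ fun i _ => integrable_finsetSum _ fun _ _ =>
    integrable_inner_of_memLp (h.memLp_apply i _) (h.memLp_apply i _)

theorem integrable_inner_radial (h : IsSobolevSelection f Df) :
    Integrable (fun x => ∑ i, inner ℝ (f i x) (Df i x x)) (ballMeas n) :=
  integrable_finsetSum _ fun i _ => integrable_inner_of_memLp (h.memLp i) (h.memLp_radial i)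

theorem integrable_radial_sq (h : IsSobolevSelection f Df) :
    Integrable (fun x => ∑ i, ‖Df i x x‖ ^ 2) (ballMeas n) :=
  integrable_finsetSum _ fun i _ => by
    simpa only [real_inner_self_eq_norm_sq] using
      integrable_inner_of_memLp (h.memLp_radial i) (h.memLp_radial i)

/-- The terms `∑ᵢ ⟨Dfᵢ · ∇χ, yᵢ⟩` of the first variations. -/
theorem integrable_grad_pairing (h : IsSobolevSelection f Df) {χ : E n → ℝ} (hχ : IsCutoff χ)
    (p : ℝ) {y : Fin Q → E n → E m} (hy : ∀ i, MemLp (y i) 2 (ballMeas n)) :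
    Integrable (fun x => ‖x‖ ^ p * ∑ i, ∑ j, fderiv ℝ χ x (basisVec j) *
      inner ℝ (Df i x (basisVec j)) (y i x)) (ballMeas n) := by
  simp_rw [Finset.mul_sum]
  refine integrable_finsetSum _ fun i _ => integrable_finsetSum _ fun j _ => ?_
  have hc := hχ.continuous_fderiv
  refine (hχ.integrable_of_fderiv p (g := fun x => fderiv ℝ χ x (basisVec j)) (by fun_prop)
    (fun x hx => by simp [hx])
    (integrable_inner_of_memLp (h.memLp_apply i (basisVec j)) (hy i))).congr ?_
  exact ae_of_all _ fun x => by ring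

/-- The weak derivative of `∑ᵢ |fᵢ|²` tested with the field `χ |x|ᵖ x`. -/
theorem weak_radial (h : IsSobolevSelection f Df) {χ : E n → ℝ} (hχ : IsCutoff χ) (p : ℝ) :
    (n + p) * (∫ x, χ x * ‖x‖ ^ p * ∑ i, ‖f i x‖ ^ 2 ∂ballMeas n) +
      ∫ x, fderiv ℝ χ x x * ‖x‖ ^ p * ∑ i, ‖f i x‖ ^ 2 ∂ballMeas n =
    - 2 * ∫ x, χ x * ‖x‖ ^ p * ∑ i, inner ℝ (f i x) (Df i x x) ∂ballMeas n := by
  have hcf := hχ.continuous_fderiv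
  have hcoord : ∀ j : Fin n, ContDiff ℝ ∞ fun x : E n => x j := fun j => by fun_prop
  -- Testing with the j-th component of χ|x|ᵖx in direction eⱼ and summing over j produces the
  -- divergence of this field; the coefficient n + p comes from n copies of the weight and the
  -- homogeneity of |x|ᵖ.
  have hz : ∀ j : Fin n, IsCutoff fun x => χ x * ‖x‖ ^ p * x j := fun j =>
    (hχ.weight p).mul (hcoord j)
  have hfd : ∀ (j : Fin n) (x : E n), fderiv ℝ (fun x => χ x * ‖x‖ ^ p * x j) x (basisVec j) =
      χ x * ‖x‖ ^ p + x j * fderiv ℝ (fun x => χ x * ‖x‖ ^ p) x (basisVec j) := by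
    intro j x
    have h1 := ((hχ.weight p).smooth.differentiable (by simp) x).hasFDerivAt.mul
      ((EuclideanSpace.proj j : E n →L[ℝ] ℝ).hasFDerivAt (x := x))
    have h2 : fderiv ℝ (fun x => χ x * ‖x‖ ^ p * x j) x = _ := h1.fderiv
    rw [h2]
    simp [basisVec]
  have hweak : ∀ j : Fin n, _ := fun j => h.weak _ (hz j).smooth (hz j).compact
    ((hz j).supp.trans Set.sdiff_subset) (basisVec j)
  have hsum := Finset.sum_congr (rfl : (Finset.univ : Finset (Fin n)) = Finset.univ)
    fun j _ => hweak j
  have hH := h.integrable_sq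
  rw [Finset.sum_neg_distrib, ← integral_finsetSum, ← integral_finsetSum] at hsum
  · have e1 : ∀ x, ∑ j, (∑ i, ‖f i x‖ ^ 2) *
        fderiv ℝ (fun x => χ x * ‖x‖ ^ p * x j) x (basisVec j) =
        (n + p) * (χ x * ‖x‖ ^ p * ∑ i, ‖f i x‖ ^ 2) +
          fderiv ℝ χ x x * ‖x‖ ^ p * ∑ i, ‖f i x‖ ^ 2 := by
      intro x
      rw [← Finset.mul_sum]
      simp_rw [hfd]
      rw [Finset.sum_add_distrib, Finset.sum_const, Finset.card_univ, Fintype.card_fin,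
        nsmul_eq_mul]
      have := map_eq_sum_basisVec (fderiv ℝ (fun x => χ x * ‖x‖ ^ p) x) x
      simp only [smul_eq_mul] at this
      rw [← this, hχ.fderiv_weight_self]
      ring
    have e2 : ∀ x, ∑ j, 2 * (∑ i, inner ℝ (f i x) (Df i x (basisVec j))) *
        (χ x * ‖x‖ ^ p * x j) = 2 * (χ x * ‖x‖ ^ p * ∑ i, inner ℝ (f i x) (Df i x x)) := by
      intro x
      have : ∀ i, inner ℝ (f i x) (Df i x x) =
          ∑ j, x j * inner ℝ (f i x) (Df i x (basisVec j)) := fun i => by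
        conv_lhs => rw [map_eq_sum_basisVec (Df i x) x, inner_sum]
        simp only [inner_smul_right]
      simp_rw [this]
      rw [Finset.sum_comm, Finset.mul_sum, Finset.mul_sum]
      refine Finset.sum_congr rfl fun j _ => ?_
      rw [← Finset.mul_sum]
      ring
    simp_rw [e1, e2] at hsum
    rw [integral_add, integral_const_mul, integral_const_mul] at hsum
    · rw [hsum]
      ring
    · exact (hχ.integrable p hH).const_mul _
    · exact hχ.integrable_of_fderiv p (g := fun x => fderiv ℝ χ x x) (by fun_prop)
        (fun x hx => by simp [hx]) hH
  · intro j _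
    refine (((hz j).integrable 0 (integrable_finsetSum Finset.univ fun i _ =>
      integrable_inner_of_memLp (h.memLp i) (h.memLp_apply i (basisVec j)))).const_mul 2).congr ?_
    exact ae_of_all _ fun x => by simp; ring
  · intro j _
    have hcz := (hz j).continuous_fderiv
    refine ((hz j).integrable_of_fderiv 0 (g := fun x =>
      fderiv ℝ (fun x => χ x * ‖x‖ ^ p * x j) x (basisVec j)) (by fun_prop)
      (fun x hx => by simp [hx]) hH).congr ?_
    exact ae_of_all _ fun x => by simp; ring

end IsSobolevSelection

/-- Linear in u, so the growth conditions hold with sup|a| + sup|Da|. -/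
theorem isOuterTest_smul {a : E n → ℝ} (ha : IsCutoff a) :
    IsOuterTest (m := m) (Metric.ball 0 1) fun x u => a x • u := by
  obtain ⟨C, hC⟩ := exists_norm_fderiv_le ha.smooth ha.compact
  obtain ⟨C', hC'⟩ := ha.smooth.continuous.bounded_above_of_compact_support ha.compact
  have hC0 : 0 ≤ C := (norm_nonneg _).trans (hC 0)
  have hC0' : 0 ≤ C' := (norm_nonneg _).trans (hC' 0)
  have hs := ha.smooth
  refine ⟨by fun_prop, ⟨tsupport a, ha.compact, ha.supp.trans Set.sdiff_subset, fun x hx u => ?_⟩,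
    C + C', fun x u => ⟨?_, ?_⟩⟩
  · simp [image_eq_zero_of_notMem_tsupport hx]
  · have : fderiv ℝ (fun u : E m => a x • u) u = a x • ContinuousLinearMap.id ℝ (E m) :=
      ((hasFDerivAt_id u).const_smul (a x)).fderiv
    rw [this, norm_smul]
    have h1 : ‖ContinuousLinearMap.id ℝ (E m)‖ ≤ 1 := ContinuousLinearMap.norm_id_le
    nlinarith [hC' x, norm_nonneg (a x), norm_nonneg (ContinuousLinearMap.id ℝ (E m))]
  · have : fderiv ℝ (fun y => a y • u) x = (fderiv ℝ a x).smulRight u :=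
      ((hs.differentiable (by simp) x).hasFDerivAt.smul_const u).fderiv
    rw [this, norm_smul, ContinuousLinearMap.norm_smulRight_apply]
    nlinarith [mul_le_mul_of_nonneg_right (hC' x) (norm_nonneg u),
      mul_le_mul_of_nonneg_right (hC x) (norm_nonneg u), norm_nonneg u]

variable {F : E n → AQ Q m} {f : Fin Q → E n → E m} {Df : Fin Q → E n → E n →L[ℝ] E m}

/-- The gradient of |x|ᵖ is radial, so it contributes the derivative A x; only the remaining part
contains Dχ and counts as a boundary term. Taking y = fᵢ and y = Dfᵢ·x serves the outer and the
inner variation. -/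
theorem sum_fderiv_weight_mul {χ : E n → ℝ} (hχ : IsCutoff χ) (p : ℝ) (x : E n)
    (A : E n →L[ℝ] E m) (y : E m) :
    ∑ j, fderiv ℝ (fun x => χ x * ‖x‖ ^ p) x (basisVec j) * inner ℝ (A (basisVec j)) y =
      ‖x‖ ^ p * (∑ j, fderiv ℝ χ x (basisVec j) * inner ℝ (A (basisVec j)) y) +
        p * (χ x * ‖x‖ ^ (p - 2) * inner ℝ y (A x)) := by
  have h1 : inner ℝ y (A x) = ∑ j, x j * inner ℝ (A (basisVec j)) y := by
    conv_lhs => rw [map_eq_sum_basisVec A x, inner_sum]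
    simp only [inner_smul_right, real_inner_comm]
  rw [h1, Finset.mul_sum, Finset.mul_sum, Finset.mul_sum, ← Finset.sum_add_distrib]
  refine Finset.sum_congr rfl fun j _ => ?_
  rw [hχ.fderiv_weight, inner_basisVec]
  ring

/-- The outer variation along `χ |x|ᵖ u`. -/
theorem outer_variation_weight (hst : IsDirStationary (Metric.ball 0 1) F f Df)
    (h : IsSobolevSelection f Df) {χ : E n → ℝ} (hχ : IsCutoff χ) (p : ℝ) :
    (∫ x, χ x * ‖x‖ ^ p * ∑ i, hsInner (Df i x) (Df i x) ∂ballMeas n) +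
      (∫ x, ‖x‖ ^ p * ∑ i, ∑ j, fderiv ℝ χ x (basisVec j) *
        inner ℝ (Df i x (basisVec j)) (f i x) ∂ballMeas n) +
      p * ∫ x, χ x * ‖x‖ ^ (p - 2) * ∑ i, inner ℝ (f i x) (Df i x x) ∂ballMeas n = 0 := by
  have key := hst.outer _ (isOuterTest_smul (hχ.weight p))
  rw [← key, outerVar, ← integral_const_mul, ← integral_add (hχ.integrable p h.integrable_energy)
    (h.integrable_grad_pairing hχ p h.memLp), ← integral_add]
  · refine integral_congr_ae (ae_of_all _ fun x => ?_)
    have e1 : ∀ i, fderiv ℝ (fun y => (χ y * ‖y‖ ^ p) • f i x) x =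
        (fderiv ℝ (fun x => χ x * ‖x‖ ^ p) x).smulRight (f i x) := fun i =>
      (((hχ.weight p).smooth.differentiable (by simp) x).hasFDerivAt.smul_const (f i x)).fderiv
    have e2 : ∀ i, fderiv ℝ (fun u : E m => (χ x * ‖x‖ ^ p) • u) (f i x) =
        (χ x * ‖x‖ ^ p) • ContinuousLinearMap.id ℝ (E m) := fun i =>
      ((hasFDerivAt_id (f i x)).const_smul (χ x * ‖x‖ ^ p)).fderiv
    have e3 : ∀ i, hsInner (Df i x) ((fderiv ℝ (fun x => χ x * ‖x‖ ^ p) x).smulRight (f i x)) =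
        ∑ j, fderiv ℝ (fun x => χ x * ‖x‖ ^ p) x (basisVec j) *
          inner ℝ (Df i x (basisVec j)) (f i x) := fun i => by
      simp [hsInner, inner_smul_right]
    have e4 : ∀ i, hsInner (Df i x)
        (((χ x * ‖x‖ ^ p) • ContinuousLinearMap.id ℝ (E m)).comp (Df i x)) =
        χ x * ‖x‖ ^ p * hsInner (Df i x) (Df i x) := fun i => by
      simp [hsInner, inner_smul_right, Finset.mul_sum]
    simp only [e1, e2, e3, e4, sum_fderiv_weight_mul hχ, Finset.sum_add_distrib,
      ← Finset.mul_sum]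
    ring
  · exact (hχ.integrable p h.integrable_energy).add (h.integrable_grad_pairing hχ p h.memLp)
  · exact (hχ.integrable (p - 2) h.integrable_inner_radial).const_mul p

/-- The inner variation along `χ |x|ᵖ x`. -/
theorem inner_variation_weight (hst : IsDirStationary (Metric.ball 0 1) F f Df)
    (h : IsSobolevSelection f Df) {χ : E n → ℝ} (hχ : IsCutoff χ) (p : ℝ) :
    2 * ((∫ x, χ x * ‖x‖ ^ p * ∑ i, hsInner (Df i x) (Df i x) ∂ballMeas n) +
      (∫ x, ‖x‖ ^ p * ∑ i, ∑ j, fderiv ℝ χ x (basisVec j) *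
        inner ℝ (Df i x (basisVec j)) (Df i x x) ∂ballMeas n) +
      p * ∫ x, χ x * ‖x‖ ^ (p - 2) * ∑ i, ‖Df i x x‖ ^ 2 ∂ballMeas n) -
    ((n + p) * (∫ x, χ x * ‖x‖ ^ p * ∑ i, hsInner (Df i x) (Df i x) ∂ballMeas n) +
      ∫ x, fderiv ℝ χ x x * ‖x‖ ^ p * ∑ i, hsInner (Df i x) (Df i x) ∂ballMeas n) = 0 := by
  have hcf := hχ.continuous_fderiv
  have hw := hχ.weight p
  have hφs : ContDiff ℝ ∞ fun x : E n => (χ x * ‖x‖ ^ p) • x := hw.smooth.smul contDiff_id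
  have hsub : tsupport (fun x : E n => (χ x * ‖x‖ ^ p) • x) ⊆
      tsupport fun x => χ x * ‖x‖ ^ p := tsupport_smul_subset_left _ _
  have key := hst.inner (fun x => (χ x * ‖x‖ ^ p) • x) hφs hw.compact.smul_right
    (hsub.trans (hw.supp.trans Set.sdiff_subset))
  have hfd : ∀ x z : E n, fderiv ℝ (fun x : E n => (χ x * ‖x‖ ^ p) • x) x z =
      (χ x * ‖x‖ ^ p) • z + fderiv ℝ (fun x => χ x * ‖x‖ ^ p) x z • x := by
    intro x z
    have h1 := ((hw.smooth.differentiable (by simp) x).hasFDerivAt.smul (hasFDerivAt_id x)).fderiv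
    have h2 : fderiv ℝ (fun x : E n => (χ x * ‖x‖ ^ p) • x) x = _ := h1
    rw [h2]
    simp
  have hdiv : ∀ x, divergence (fun x : E n => (χ x * ‖x‖ ^ p) • x) x =
      (n + p) * (χ x * ‖x‖ ^ p) + fderiv ℝ χ x x * ‖x‖ ^ p := by
    intro x
    have h1 := map_eq_sum_basisVec (fderiv ℝ (fun x => χ x * ‖x‖ ^ p) x) x
    simp only [smul_eq_mul] at h1
    unfold divergence
    simp_rw [hfd]
    simp only [PiLp.add_apply, PiLp.smul_apply, smul_eq_mul, Finset.sum_add_distrib,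
      mul_comm _ (x _), ← h1, hχ.fderiv_weight_self]
    simp [basisVec]
    ring
  have hhs : ∀ x, ∑ i, hsInner (Df i x)
      ((Df i x).comp (fderiv ℝ (fun x : E n => (χ x * ‖x‖ ^ p) • x) x)) =
      χ x * ‖x‖ ^ p * (∑ i, hsInner (Df i x) (Df i x)) +
      ‖x‖ ^ p * (∑ i, ∑ j, fderiv ℝ χ x (basisVec j) *
        inner ℝ (Df i x (basisVec j)) (Df i x x)) +
      p * (χ x * ‖x‖ ^ (p - 2) * ∑ i, ‖Df i x x‖ ^ 2) := by
    intro x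
    have e1 : ∀ i, hsInner (Df i x)
        ((Df i x).comp (fderiv ℝ (fun x : E n => (χ x * ‖x‖ ^ p) • x) x)) =
        χ x * ‖x‖ ^ p * hsInner (Df i x) (Df i x) +
        ∑ j, fderiv ℝ (fun x => χ x * ‖x‖ ^ p) x (basisVec j) *
          inner ℝ (Df i x (basisVec j)) (Df i x x) := fun i => by
      simp only [hsInner, ContinuousLinearMap.comp_apply, hfd, map_add, map_smul, inner_add_right,
        inner_smul_right, Finset.sum_add_distrib, Finset.mul_sum]
    simp only [e1, sum_fderiv_weight_mul hχ, Finset.sum_add_distrib, ← Finset.mul_sum,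
      real_inner_self_eq_norm_sq]
    ring
  have hD := h.integrable_energy
  have i1 := hχ.integrable p hD
  have i2 := h.integrable_grad_pairing hχ p h.memLp_radial
  have i3 := (hχ.integrable (p - 2) h.integrable_radial_sq).const_mul p
  have i4 := hχ.integrable_of_fderiv p (g := fun x => fderiv ℝ χ x x) (by fun_prop)
    (fun x hx => by simp [hx]) hD
  rw [← key, innerVar]
  simp_rw [hhs, hdiv]
  congr 1
  · have i12 : Integrable (fun x => χ x * ‖x‖ ^ p * (∑ i, hsInner (Df i x) (Df i x)) +
        ‖x‖ ^ p * ∑ i, ∑ j, fderiv ℝ χ x (basisVec j) *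
          inner ℝ (Df i x (basisVec j)) (Df i x x)) (ballMeas n) := i1.add i2
    rw [← integral_const_mul p, ← integral_add i1 i2, ← integral_add i12 i3]
  · rw [← integral_const_mul, ← integral_add (i1.const_mul _) i4]
    exact integral_congr_ae (ae_of_all _ fun x => by ring)

end Variations

/-! ### Boundary terms and the estimate for nonnegative cutoffs -/

section Estimate

variable {n m Q : ℕ} {F : E n → AQ Q m} {f : Fin Q → E n → E m}
  {Df : Fin Q → E n → E n →L[ℝ] E m} {χ : E n → ℝ}

theorem hsInner_self (A : E n →L[ℝ] E m) : hsInner A A = ∑ j, ‖A (basisVec j)‖ ^ 2 := by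
  simp [hsInner]

theorem hsInner_self_nonneg (A : E n →L[ℝ] E m) : 0 ≤ hsInner A A := by
  rw [hsInner_self]
  positivity

theorem norm_apply_sq_le (A : E n →L[ℝ] E m) (x : E n) :
    ‖A x‖ ^ 2 ≤ ‖x‖ ^ 2 * hsInner A A := by
  have h1 : ‖A x‖ ≤ ∑ j, ‖x j‖ * ‖A (basisVec j)‖ := by
    rw [map_eq_sum_basisVec A x]
    refine (norm_sum_le _ _).trans_eq ?_
    simp only [norm_smul]
  calc ‖A x‖ ^ 2 ≤ (∑ j, ‖x j‖ * ‖A (basisVec j)‖) ^ 2 := by gcongr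
    _ ≤ (∑ j, ‖x j‖ ^ 2) * ∑ j, ‖A (basisVec j)‖ ^ 2 := Finset.sum_mul_sq_le_sq_mul_sq _ _ _
    _ = ‖x‖ ^ 2 * hsInner A A := by rw [EuclideanSpace.norm_sq_eq, hsInner_self]

/-- Young's inequality for `⟨A · ∇χ, y⟩`. -/
theorem abs_sum_mul_inner_le (ℓ : E n →L[ℝ] ℝ) (A : E n →L[ℝ] E m) (y : E m) {r : ℝ}
    (hr : 0 < r) :
    |∑ j, ℓ (basisVec j) * inner ℝ (A (basisVec j)) y| ≤
      ‖ℓ‖ * (r * hsInner A A + n * (r⁻¹ * ‖y‖ ^ 2)) := by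
  have h1 : ∀ j : Fin n, |ℓ (basisVec j) * inner ℝ (A (basisVec j)) y| ≤
      ‖ℓ‖ * (r * ‖A (basisVec j)‖ ^ 2 + r⁻¹ * ‖y‖ ^ 2) := by
    intro j
    rw [abs_mul]
    have h2 : |ℓ (basisVec j)| ≤ ‖ℓ‖ := by
      simpa [norm_basisVec] using ℓ.le_opNorm (basisVec j)
    have h3 : ‖A (basisVec j)‖ * ‖y‖ ≤ r * ‖A (basisVec j)‖ ^ 2 + r⁻¹ * ‖y‖ ^ 2 := by
      have h4 : r * r⁻¹ = 1 := mul_inv_cancel₀ hr.ne'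
      have h5 : 0 < r⁻¹ := inv_pos.2 hr
      have h6 : 0 ≤ r⁻¹ * (r * ‖A (basisVec j)‖ - ‖y‖) ^ 2 := by positivity
      have h7 : r⁻¹ * (r * ‖A (basisVec j)‖ - ‖y‖) ^ 2 = r * ‖A (basisVec j)‖ ^ 2 -
          2 * (‖A (basisVec j)‖ * ‖y‖) + r⁻¹ * ‖y‖ ^ 2 := by
        linear_combination (r * ‖A (basisVec j)‖ ^ 2 - 2 * ‖A (basisVec j)‖ * ‖y‖) * h4
      have h8 : 0 ≤ ‖A (basisVec j)‖ * ‖y‖ := by positivity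
      linarith
    exact mul_le_mul h2 ((abs_real_inner_le_norm _ _).trans h3) (abs_nonneg _) (norm_nonneg _)
  refine (Finset.abs_sum_le_sum_abs _ _).trans ((Finset.sum_le_sum fun j _ => h1 j).trans_eq ?_)
  rw [← Finset.mul_sum, Finset.sum_add_distrib, ← Finset.mul_sum, hsInner_self]
  simp

theorem carlemanRHS_eq (τ : ℝ) (χ : E n → ℝ) (x : E n) : carlemanRHS f Df τ χ x =
    ‖fderiv ℝ χ x‖ * ‖x‖ ^ (-(2 * τ - 1)) * (∑ i, hsInner (Df i x) (Df i x)) +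
      ‖fderiv ℝ χ x‖ * ‖x‖ ^ (-(2 * τ + 1)) * ∑ i, ‖f i x‖ ^ 2 := by
  rw [carlemanRHS, Finset.sum_add_distrib, ← Finset.sum_div, ← Finset.sum_div,
    Real.rpow_neg (norm_nonneg _), Real.rpow_neg (norm_nonneg _)]
  ring

theorem carlemanRHS_nonneg (τ : ℝ) (χ : E n → ℝ) (x : E n) : 0 ≤ carlemanRHS f Df τ χ x := by
  have h1 := Finset.sum_nonneg fun i (_ : i ∈ (Finset.univ : Finset (Fin Q))) =>
    hsInner_self_nonneg (Df i x)
  rw [carlemanRHS_eq]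
  positivity

theorem integrable_carlemanRHS (h : IsSobolevSelection f Df) (hχ : IsCutoff χ) (τ : ℝ) :
    Integrable (carlemanRHS f Df τ χ) (ballMeas n) := by
  have hc := hχ.continuous_fderiv
  have e : carlemanRHS f Df τ χ = fun x => _ := funext fun x => carlemanRHS_eq τ χ x
  rw [e]
  exact (hχ.integrable_of_fderiv _ (g := fun x => ‖fderiv ℝ χ x‖) (by fun_prop)
    (fun x hx => by simp [hx]) h.integrable_energy).add
    (hχ.integrable_of_fderiv _ (g := fun x => ‖fderiv ℝ χ x‖) (by fun_prop)
    (fun x hx => by simp [hx]) h.integrable_sq)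

/-- The radial defect `∑ᵢ |Dfᵢ · x - η fᵢ|²`. -/
noncomputable def radialDefect (f : Fin Q → E n → E m) (Df : Fin Q → E n → E n →L[ℝ] E m)
    (η : ℝ) (x : E n) : ℝ := ∑ i, ‖Df i x x - η • f i x‖ ^ 2

theorem radialDefect_eq (η : ℝ) (x : E n) : radialDefect f Df η x =
    (∑ i, ‖Df i x x‖ ^ 2) - 2 * η * (∑ i, inner ℝ (f i x) (Df i x x)) +
      η ^ 2 * ∑ i, ‖f i x‖ ^ 2 := by
  rw [radialDefect, Finset.mul_sum, Finset.mul_sum, ← Finset.sum_sub_distrib,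
    ← Finset.sum_add_distrib]
  refine Finset.sum_congr rfl fun i _ => ?_
  rw [norm_sub_sq_real, inner_smul_right, norm_smul, mul_pow, Real.norm_eq_abs, sq_abs,
    real_inner_comm]
  ring

theorem integrable_radialDefect (h : IsSobolevSelection f Df) (η : ℝ) :
    Integrable (radialDefect f Df η) (ballMeas n) := by
  have e : radialDefect f Df η = fun x => _ := funext fun x => radialDefect_eq η x
  rw [e]
  exact (h.integrable_radial_sq.sub (h.integrable_inner_radial.const_mul _)).add
    (h.integrable_sq.const_mul _)

theorem radialDefect_nonneg (η : ℝ) (x : E n) : 0 ≤ radialDefect f Df η x :=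
  Finset.sum_nonneg fun _ _ => sq_nonneg _

theorem carlemanLHS_eq (τ ε : ℝ) (χ : E n → ℝ) (x : E n) : carlemanLHS f Df τ ε χ x =
    ε ^ 2 * (χ x * ‖x‖ ^ (-(2 * τ + 2 - ε)) * ∑ i, ‖f i x‖ ^ 2) +
      χ x * ‖x‖ ^ (-(2 * τ + 2)) * radialDefect f Df ((2 * τ - n + 2) / 2) x := by
  rw [carlemanLHS, Finset.sum_add_distrib, ← Finset.mul_sum, ← Finset.sum_div, ← Finset.sum_div,
    Real.rpow_neg (norm_nonneg _), Real.rpow_neg (norm_nonneg _), radialDefect]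
  ring

theorem integrable_carlemanLHS (h : IsSobolevSelection f Df) (hχ : IsCutoff χ) (τ ε : ℝ) :
    Integrable (carlemanLHS f Df τ ε χ) (ballMeas n) := by
  have e : carlemanLHS f Df τ ε χ = fun x => _ := funext fun x => carlemanLHS_eq τ ε χ x
  rw [e]
  exact ((hχ.integrable _ h.integrable_sq).const_mul _).add
    (hχ.integrable _ (integrable_radialDefect h _))

/-- The value at the origin is prescribed separately because the weights degenerate there and, for n
= 0, the origin has positive measure. -/
theorem abs_integral_le_carlemanRHS (h : IsSobolevSelection f Df) (hχ : IsCutoff χ) (τ : ℝ)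
    {u : E n → ℝ} {c : ℝ} (hc : 0 ≤ c)
    (hu : ∀ x, x ≠ 0 → ‖x‖ < 1 → |u x| ≤ c * carlemanRHS f Df τ χ x) (h0 : u 0 = 0) :
    |∫ x, u x ∂ballMeas n| ≤ c * ∫ x, carlemanRHS f Df τ χ x ∂ballMeas n := by
  rw [← integral_const_mul, ← Real.norm_eq_abs]
  refine norm_integral_le_of_norm_le ((integrable_carlemanRHS h hχ τ).const_mul c) ?_
  filter_upwards [ae_restrict_mem measurableSet_ball] with x hx
  by_cases hx0 : x = 0
  · rw [hx0, h0, norm_zero]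
    exact mul_nonneg hc (carlemanRHS_nonneg _ _ _)
  · exact hu x hx0 (mem_ball_zero_iff.1 hx)

theorem abs_integral_outer_le (h : IsSobolevSelection f Df) (hχ : IsCutoff χ) (τ : ℝ) :
    |∫ x, ‖x‖ ^ (-(2 * τ)) * ∑ i, ∑ j, fderiv ℝ χ x (basisVec j) *
        inner ℝ (Df i x (basisVec j)) (f i x) ∂ballMeas n| ≤
      (n + 1) * ∫ x, carlemanRHS f Df τ χ x ∂ballMeas n := by
  refine abs_integral_le_carlemanRHS h hχ τ (by positivity) (fun x hx _ => ?_)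
    (by simp [hχ.fderiv_zero])
  have hr : 0 < ‖x‖ := norm_pos_iff.2 hx
  have e1 : ‖x‖ ^ (-(2 * τ - 1)) = ‖x‖ ^ (-(2 * τ)) * ‖x‖ := by
    rw [← Real.rpow_add_one hr.ne']
    congr 1
    ring
  have e2 : ‖x‖ ^ (-(2 * τ + 1)) = ‖x‖ ^ (-(2 * τ)) * ‖x‖⁻¹ := by
    rw [← Real.rpow_neg_one, ← Real.rpow_add hr]
    congr 1
    ring
  have hD := Finset.sum_nonneg fun i (_ : i ∈ (Finset.univ : Finset (Fin Q))) =>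
    hsInner_self_nonneg (Df i x)
  rw [carlemanRHS_eq, e1, e2, abs_mul, abs_of_nonneg (by positivity)]
  -- Young's parameter r = |x| yields exactly the two weights of the right-hand side, with
  -- coefficients 1 and n.
  have h1 : |∑ i, ∑ j, fderiv ℝ χ x (basisVec j) * inner ℝ (Df i x (basisVec j)) (f i x)| ≤
      ‖fderiv ℝ χ x‖ * (‖x‖ * (∑ i, hsInner (Df i x) (Df i x)) +
        n * (‖x‖⁻¹ * ∑ i, ‖f i x‖ ^ 2)) := by
    refine (Finset.abs_sum_le_sum_abs _ _).trans ((Finset.sum_le_sum fun i _ =>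
      abs_sum_mul_inner_le (fderiv ℝ χ x) (Df i x) (f i x) hr).trans_eq ?_)
    rw [← Finset.mul_sum, Finset.sum_add_distrib, Finset.mul_sum, Finset.mul_sum, Finset.mul_sum]
  refine (mul_le_mul_of_nonneg_left h1 (by positivity)).trans ?_
  have h2 : 0 ≤ ‖x‖ ^ (-(2 * τ)) * ‖fderiv ℝ χ x‖ * (n * (‖x‖ *
    (∑ i, hsInner (Df i x) (Df i x))) + ‖x‖⁻¹ * ∑ i, ‖f i x‖ ^ 2) := by positivity
  linarith

theorem abs_integral_inner_le (h : IsSobolevSelection f Df) (hχ : IsCutoff χ) (τ : ℝ) :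
    |∫ x, ‖x‖ ^ (-(2 * τ)) * ∑ i, ∑ j, fderiv ℝ χ x (basisVec j) *
        inner ℝ (Df i x (basisVec j)) (Df i x x) ∂ballMeas n| ≤
      (n + 1) * ∫ x, carlemanRHS f Df τ χ x ∂ballMeas n := by
  refine abs_integral_le_carlemanRHS h hχ τ (by positivity) (fun x hx _ => ?_)
    (by simp)
  have hr : 0 < ‖x‖ := norm_pos_iff.2 hx
  have e1 : ‖x‖ ^ (-(2 * τ - 1)) = ‖x‖ ^ (-(2 * τ)) * ‖x‖ := by
    rw [← Real.rpow_add_one hr.ne']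
    congr 1
    ring
  rw [carlemanRHS_eq, e1, abs_mul, abs_of_nonneg (by positivity)]
  have h1 : |∑ i, ∑ j, fderiv ℝ χ x (basisVec j) * inner ℝ (Df i x (basisVec j)) (Df i x x)| ≤
      ‖fderiv ℝ χ x‖ * ((n + 1) * (‖x‖ * ∑ i, hsInner (Df i x) (Df i x))) := by
    rw [Finset.mul_sum, Finset.mul_sum, Finset.mul_sum]
    refine (Finset.abs_sum_le_sum_abs _ _).trans (Finset.sum_le_sum fun i _ =>
      (abs_sum_mul_inner_le (fderiv ℝ χ x) (Df i x) (Df i x x) hr).trans ?_)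
    refine mul_le_mul_of_nonneg_left ?_ (norm_nonneg _)
    -- As |Df·x| ≤ |x||Df|, both terms of Young's inequality become multiples of |x||Df|².
    have h2 : ‖x‖⁻¹ * ‖Df i x x‖ ^ 2 ≤ ‖x‖ * hsInner (Df i x) (Df i x) := by
      rw [inv_mul_le_iff₀ hr, ← mul_assoc, ← sq]
      exact norm_apply_sq_le _ _
    have h3 : (n : ℝ) * (‖x‖⁻¹ * ‖Df i x x‖ ^ 2) ≤ n * (‖x‖ * hsInner (Df i x) (Df i x)) := by
      gcongr
    linarith
  refine (mul_le_mul_of_nonneg_left h1 (by positivity)).trans ?_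
  have h2 : 0 ≤ ‖fderiv ℝ χ x‖ * ‖x‖ ^ (-(2 * τ + 1)) * ∑ i, ‖f i x‖ ^ 2 := by positivity
  have h3 : 0 ≤ (n : ℝ) * (‖fderiv ℝ χ x‖ * ‖x‖ ^ (-(2 * τ + 1)) * ∑ i, ‖f i x‖ ^ 2) := by
    positivity
  linarith

theorem abs_fderiv_apply_self_le (χ : E n → ℝ) (x : E n) :
    |fderiv ℝ χ x x| ≤ ‖fderiv ℝ χ x‖ * ‖x‖ := (fderiv ℝ χ x).le_opNorm x

theorem abs_integral_energy_le (h : IsSobolevSelection f Df) (hχ : IsCutoff χ) (τ : ℝ) :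
    |∫ x, fderiv ℝ χ x x * ‖x‖ ^ (-(2 * τ)) * ∑ i, hsInner (Df i x) (Df i x) ∂ballMeas n| ≤
      ∫ x, carlemanRHS f Df τ χ x ∂ballMeas n := by
  rw [← one_mul (∫ x, carlemanRHS f Df τ χ x ∂ballMeas n)]
  refine abs_integral_le_carlemanRHS h hχ τ zero_le_one (fun x hx _ => ?_) (by simp)
  have hr : 0 < ‖x‖ := norm_pos_iff.2 hx
  have hD := Finset.sum_nonneg fun i (_ : i ∈ (Finset.univ : Finset (Fin Q))) =>
    hsInner_self_nonneg (Df i x)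
  have e1 : ‖x‖ ^ (-(2 * τ - 1)) = ‖x‖ ^ (-(2 * τ)) * ‖x‖ := by
    rw [← Real.rpow_add_one hr.ne']
    congr 1
    ring
  rw [carlemanRHS_eq, e1, abs_mul, abs_mul, abs_of_nonneg hD,
    abs_of_nonneg (Real.rpow_nonneg hr.le _), one_mul]
  have h1 : |fderiv ℝ χ x x| * ‖x‖ ^ (-(2 * τ)) * ∑ i, hsInner (Df i x) (Df i x) ≤
      ‖fderiv ℝ χ x‖ * ‖x‖ * ‖x‖ ^ (-(2 * τ)) * ∑ i, hsInner (Df i x) (Df i x) := by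
    gcongr
    exact abs_fderiv_apply_self_le χ x
  have h2 : 0 ≤ ‖fderiv ℝ χ x‖ * ‖x‖ ^ (-(2 * τ + 1)) * ∑ i, ‖f i x‖ ^ 2 := by positivity
  linarith

/-- The factor |x| from Dχ·x raises the exponent to ε - 1 - 2τ, and |x| < 1 allows ε to be dropped.
The case ε = 0 serves the radial defect, ε > 0 the mass term. -/
theorem abs_integral_mass_le (h : IsSobolevSelection f Df) (hχ : IsCutoff χ) (τ : ℝ) {ε : ℝ}
    (hε : 0 ≤ ε) :
    |∫ x, fderiv ℝ χ x x * ‖x‖ ^ (-(2 * τ + 2 - ε)) * ∑ i, ‖f i x‖ ^ 2 ∂ballMeas n| ≤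
      ∫ x, carlemanRHS f Df τ χ x ∂ballMeas n := by
  rw [← one_mul (∫ x, carlemanRHS f Df τ χ x ∂ballMeas n)]
  refine abs_integral_le_carlemanRHS h hχ τ zero_le_one (fun x hx hx1 => ?_) (by simp)
  have hr : 0 < ‖x‖ := norm_pos_iff.2 hx
  have hD := Finset.sum_nonneg fun i (_ : i ∈ (Finset.univ : Finset (Fin Q))) =>
    hsInner_self_nonneg (Df i x)
  have e1 : ‖x‖ * ‖x‖ ^ (-(2 * τ + 2 - ε)) ≤ ‖x‖ ^ (-(2 * τ + 1)) := by
    rw [mul_comm, ← Real.rpow_add_one hr.ne']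
    exact Real.rpow_le_rpow_of_exponent_ge hr hx1.le (by linarith)
  rw [carlemanRHS_eq, abs_mul, abs_mul, abs_of_nonneg (by positivity : 0 ≤ ∑ i, ‖f i x‖ ^ 2),
    abs_of_nonneg (Real.rpow_nonneg hr.le _), one_mul]
  have h1 : |fderiv ℝ χ x x| * ‖x‖ ^ (-(2 * τ + 2 - ε)) ≤
      ‖fderiv ℝ χ x‖ * ‖x‖ ^ (-(2 * τ + 1)) :=
    calc |fderiv ℝ χ x x| * ‖x‖ ^ (-(2 * τ + 2 - ε))
        ≤ ‖fderiv ℝ χ x‖ * ‖x‖ * ‖x‖ ^ (-(2 * τ + 2 - ε)) := by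
          gcongr
          exact abs_fderiv_apply_self_le χ x
      _ = ‖fderiv ℝ χ x‖ * (‖x‖ * ‖x‖ ^ (-(2 * τ + 2 - ε))) := by ring
      _ ≤ _ := by gcongr
  have h2 : 0 ≤ ‖fderiv ℝ χ x‖ * ‖x‖ ^ (-(2 * τ - 1)) * ∑ i, hsInner (Df i x) (Df i x) := by
    positivity
  have h3 := mul_le_mul_of_nonneg_right h1 (by positivity : 0 ≤ ∑ i, ‖f i x‖ ^ 2)
  linarith

theorem integral_radialDefect_eq (h : IsSobolevSelection f Df) (hχ : IsCutoff χ) (p η : ℝ) :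
    ∫ x, χ x * ‖x‖ ^ p * radialDefect f Df η x ∂ballMeas n =
      (∫ x, χ x * ‖x‖ ^ p * ∑ i, ‖Df i x x‖ ^ 2 ∂ballMeas n) -
      2 * η * (∫ x, χ x * ‖x‖ ^ p * ∑ i, inner ℝ (f i x) (Df i x x) ∂ballMeas n) +
      η ^ 2 * ∫ x, χ x * ‖x‖ ^ p * ∑ i, ‖f i x‖ ^ 2 ∂ballMeas n := by
  have i1 := hχ.integrable p h.integrable_radial_sq
  have i2 := (hχ.integrable p h.integrable_inner_radial).const_mul (2 * η)
  have i3 := (hχ.integrable p h.integrable_sq).const_mul (η ^ 2)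
  rw [← integral_const_mul, ← integral_const_mul, ← integral_sub i1 i2, ← integral_add _ i3]
  · refine integral_congr_ae (ae_of_all _ fun x => ?_)
    simp only [radialDefect_eq]
    ring
  · exact i1.sub i2

/-- Linear elimination. The relation between d, τ and η turns the coefficient of KD in the inner
identity into 2η and that of KH into -2η; the outer identity then removes KD and the weak one
completes the square. -/
theorem abs_le_of_variation_identities {τ η d KD KN KS KH O I XD XH R : ℝ} (hτ : 0 < τ)
    (hd0 : 0 ≤ d) (hd : d = 2 * τ + 2 - 2 * η) (ho : KD + O + -(2 * τ) * KS = 0)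
    (hi : 2 * (KD + I + -(2 * τ) * KN) - ((d + -(2 * τ)) * KD + XD) = 0)
    (hw : (d + -(2 * τ + 2)) * KH + XH = -2 * KS) (bo : |O| ≤ (d + 1) * R)
    (bi : |I| ≤ (d + 1) * R) (be : |XD| ≤ R) (bm : |XH| ≤ R) :
    |KN - 2 * η * KS + η ^ 2 * KH| ≤ 2 * (d + 2) ^ 2 * (1 + τ + 1 / τ) * R := by
  have hR : 0 ≤ R := (abs_nonneg _).trans be
  have e1 : 4 * τ * (KN - 2 * η * KS + η ^ 2 * KH) =
      2 * I - XD - 2 * (η * O) + 2 * τ * (η * XH) := by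
    rw [hd] at hi hw
    linear_combination -hi + 2 * η * ho - 2 * τ * η * hw
  have hη : |η| ≤ τ + (d + 2) := by
    rw [abs_le]
    constructor <;> linarith
  set N : ℝ := d + 2 with hN
  have hN2 : 2 ≤ N := by linarith
  have bO : |η * O| ≤ (τ + N) * (N * R) := by
    rw [abs_mul]
    refine mul_le_mul hη (bo.trans ?_) (abs_nonneg _) (by linarith)
    gcongr
    linarith
  have bI : |I| ≤ N * R := bi.trans (by gcongr; linarith)
  have bX : |η * XH| ≤ (τ + N) * R := by
    rw [abs_mul]
    exact mul_le_mul hη bm (abs_nonneg _) (by linarith)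
  have bX' : |2 * τ * (η * XH)| ≤ 2 * τ * ((τ + N) * R) := by
    rw [abs_mul, abs_of_pos (by linarith : 0 < 2 * τ)]
    gcongr
  have b1 : |4 * τ * (KN - 2 * η * KS + η ^ 2 * KH)| ≤
      2 * (N * R) + R + 2 * ((τ + N) * (N * R)) + 2 * τ * ((τ + N) * R) := by
    rw [e1]
    rw [abs_le] at bO bI bX' be ⊢
    constructor <;> linarith
  rw [abs_mul, abs_of_pos (by linarith : 0 < 4 * τ)] at b1
  have b2 : 4 * τ * (2 * N ^ 2 * (1 + τ + 1 / τ) * R) =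
      (8 * N ^ 2 * τ + 8 * N ^ 2 * τ ^ 2 + 8 * N ^ 2) * R := by
    field_simp
    ring
  -- Crude absorption: N ≥ 2 bounds every power of N that occurs by N², leaving the powers 1, τ, τ²
  -- that 4τ(1 + τ + 1/τ) supplies.
  have b3 : 2 * N + 1 + 2 * (τ + N) * N + 2 * τ * (τ + N) ≤
      8 * N ^ 2 * τ + 8 * N ^ 2 * τ ^ 2 + 8 * N ^ 2 := by
    have c1 : 2 * N ≤ N ^ 2 := by nlinarith
    have c2 : τ * (2 * N) ≤ τ * N ^ 2 := mul_le_mul_of_nonneg_left c1 hτ.le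
    have c3 : τ ^ 2 * 2 ≤ τ ^ 2 * N ^ 2 := by
      gcongr
      linarith
    have c4 : 0 ≤ τ * N ^ 2 := by positivity
    have c5 : 0 ≤ τ ^ 2 * N ^ 2 := by positivity
    linarith
  have b4 := mul_le_mul_of_nonneg_right b3 hR
  refine le_of_mul_le_mul_left ?_ (by linarith : 0 < 4 * τ)
  rw [b2]
  linarith

/-- The radial defect is controlled by the boundary terms. -/
theorem abs_integral_radialDefect_le (hst : IsDirStationary (Metric.ball 0 1) F f Df)
    (h : IsSobolevSelection f Df) (hχ : IsCutoff χ) {τ : ℝ} (hτ : 0 < τ) :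
    |∫ x, χ x * ‖x‖ ^ (-(2 * τ + 2)) *
      radialDefect f Df ((2 * τ - n + 2) / 2) x ∂ballMeas n| ≤
      2 * (n + 2) ^ 2 * (1 + τ + 1 / τ) * ∫ x, carlemanRHS f Df τ χ x ∂ballMeas n := by
  set η : ℝ := (2 * τ - n + 2) / 2 with hη
  have ho := outer_variation_weight hst h hχ (-(2 * τ))
  have hi := inner_variation_weight hst h hχ (-(2 * τ))
  have hw := h.weak_radial hχ (-(2 * τ + 2))
  have bo := abs_integral_outer_le h hχ τ
  have bi := abs_integral_inner_le h hχ τ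
  have be := abs_integral_energy_le h hχ τ
  have bm := abs_integral_mass_le h hχ τ le_rfl
  rw [show -(2 * τ) - 2 = -(2 * τ + 2) by ring] at ho hi
  rw [sub_zero] at bm
  rw [integral_radialDefect_eq h hχ]
  set R := ∫ x, carlemanRHS f Df τ χ x ∂ballMeas n
  set KD := ∫ x, χ x * ‖x‖ ^ (-(2 * τ)) * ∑ i, hsInner (Df i x) (Df i x) ∂ballMeas n
  set KN := ∫ x, χ x * ‖x‖ ^ (-(2 * τ + 2)) * ∑ i, ‖Df i x x‖ ^ 2 ∂ballMeas n
  set KS := ∫ x, χ x * ‖x‖ ^ (-(2 * τ + 2)) * ∑ i, inner ℝ (f i x) (Df i x x) ∂ballMeas n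
  set KH := ∫ x, χ x * ‖x‖ ^ (-(2 * τ + 2)) * ∑ i, ‖f i x‖ ^ 2 ∂ballMeas n
  set O := ∫ x, ‖x‖ ^ (-(2 * τ)) * ∑ i, ∑ j, fderiv ℝ χ x (basisVec j) *
        inner ℝ (Df i x (basisVec j)) (f i x) ∂ballMeas n
  set I := ∫ x, ‖x‖ ^ (-(2 * τ)) * ∑ i, ∑ j, fderiv ℝ χ x (basisVec j) *
        inner ℝ (Df i x (basisVec j)) (Df i x x) ∂ballMeas n
  set XD := ∫ x, fderiv ℝ χ x x * ‖x‖ ^ (-(2 * τ)) * ∑ i, hsInner (Df i x) (Df i x) ∂ballMeas n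
  set XH := ∫ x, fderiv ℝ χ x x * ‖x‖ ^ (-(2 * τ + 2)) * ∑ i, ‖f i x‖ ^ 2 ∂ballMeas n
  exact abs_le_of_variation_identities hτ (Nat.cast_nonneg n) (by rw [hη]; ring)
    ho hi hw bo bi be bm

/-- The mass term is controlled by the radial defect and the boundary terms. -/
theorem integral_mass_le (h : IsSobolevSelection f Df) (hχ : IsCutoff χ) (hpos : ∀ x, 0 ≤ χ x)
    (τ : ℝ) {ε : ℝ} (hε : 0 < ε) :
    ε ^ 2 * (∫ x, χ x * ‖x‖ ^ (-(2 * τ + 2 - ε)) * ∑ i, ‖f i x‖ ^ 2 ∂ballMeas n) ≤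
      4 * (∫ x, χ x * ‖x‖ ^ (-(2 * τ + 2)) *
        radialDefect f Df ((2 * τ - n + 2) / 2) x ∂ballMeas n) +
      2 * ε * ∫ x, carlemanRHS f Df τ χ x ∂ballMeas n := by
  set η : ℝ := (2 * τ - n + 2) / 2 with hη
  have hw := h.weak_radial hχ (-(2 * τ + 2 - ε))
  have bm := abs_integral_mass_le h hχ τ hε.le
  -- Here |x| < 1 and χ ≥ 0 are needed to exchange the weights.
  have hY : ∫ x, χ x * ‖x‖ ^ (-(2 * τ + 2 - ε)) * radialDefect f Df η x ∂ballMeas n ≤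
      ∫ x, χ x * ‖x‖ ^ (-(2 * τ + 2)) * radialDefect f Df η x ∂ballMeas n := by
    refine integral_mono_ae (hχ.integrable _ (integrable_radialDefect h η))
      (hχ.integrable _ (integrable_radialDefect h η)) ?_
    filter_upwards [ae_restrict_mem measurableSet_ball] with x hx
    by_cases hx0 : x = 0
    · simp [hx0, hχ.apply_zero]
    · have hr : 0 < ‖x‖ := norm_pos_iff.2 hx0
      have h1 : ‖x‖ ^ (-(2 * τ + 2 - ε)) ≤ ‖x‖ ^ (-(2 * τ + 2)) :=
        Real.rpow_le_rpow_of_exponent_ge hr (mem_ball_zero_iff.1 hx).le (by linarith)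
      exact mul_le_mul_of_nonneg_right (mul_le_mul_of_nonneg_left h1 (hpos x))
        (radialDefect_nonneg _ _)
  -- The left side is -⟨f, Df·x - ηf⟩ in disguise. The weight ε/4 is chosen so that, after doubling,
  -- half of the coefficient ε of the mass term survives.
  have hyoung : ∫ x, χ x * ‖x‖ ^ (-(2 * τ + 2 - ε)) *
      (η * (∑ i, ‖f i x‖ ^ 2) - ∑ i, inner ℝ (f i x) (Df i x x)) ∂ballMeas n ≤
      ∫ x, χ x * ‖x‖ ^ (-(2 * τ + 2 - ε)) *
        (ε / 4 * (∑ i, ‖f i x‖ ^ 2) + 1 / ε * radialDefect f Df η x) ∂ballMeas n := by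
    refine integral_mono
      (hχ.integrable _ ((h.integrable_sq.const_mul _).sub h.integrable_inner_radial))
      (hχ.integrable _ ((h.integrable_sq.const_mul _).add
        ((integrable_radialDefect h η).const_mul _))) fun x => ?_
    refine mul_le_mul_of_nonneg_left ?_ (mul_nonneg (hpos x) (Real.rpow_nonneg (norm_nonneg _) _))
    rw [radialDefect, Finset.mul_sum, Finset.mul_sum, Finset.mul_sum, ← Finset.sum_sub_distrib,
      ← Finset.sum_add_distrib]
    refine Finset.sum_le_sum fun i _ => ?_
    have e1 : η * ‖f i x‖ ^ 2 - inner ℝ (f i x) (Df i x x) =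
        - inner ℝ (f i x) (Df i x x - η • f i x) := by
      rw [inner_sub_right, inner_smul_right, real_inner_self_eq_norm_sq]
      ring
    have e2 := abs_real_inner_le_norm (f i x) (Df i x x - η • f i x)
    have e3 : ε / 4 * ‖f i x‖ ^ 2 + 1 / ε * ‖Df i x x - η • f i x‖ ^ 2 -
        ‖f i x‖ * ‖Df i x x - η • f i x‖ =
        1 / ε * (ε / 2 * ‖f i x‖ - ‖Df i x x - η • f i x‖) ^ 2 := by
      field_simp
      ring
    have e4 : 0 ≤ 1 / ε * (ε / 2 * ‖f i x‖ - ‖Df i x x - η • f i x‖) ^ 2 := by positivity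
    rw [e1]
    linarith [neg_abs_le (inner ℝ (f i x) (Df i x x - η • f i x))]
  have i1 := hχ.integrable (-(2 * τ + 2 - ε)) h.integrable_sq
  have i2 := hχ.integrable (-(2 * τ + 2 - ε)) h.integrable_inner_radial
  have i3 := hχ.integrable (-(2 * τ + 2 - ε)) (integrable_radialDefect h η)
  simp only [mul_sub, mul_add, mul_left_comm _ η, mul_left_comm _ (ε / 4),
    mul_left_comm _ (1 / ε)] at hyoung
  rw [integral_sub (i1.const_mul _) i2, integral_add (i1.const_mul _) (i3.const_mul _),
    integral_const_mul, integral_const_mul, integral_const_mul] at hyoung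
  set R := ∫ x, carlemanRHS f Df τ χ x ∂ballMeas n
  set X := ∫ x, χ x * ‖x‖ ^ (-(2 * τ + 2 - ε)) * ∑ i, ‖f i x‖ ^ 2 ∂ballMeas n
  set S := ∫ x, χ x * ‖x‖ ^ (-(2 * τ + 2 - ε)) *
    ∑ i, inner ℝ (f i x) (Df i x x) ∂ballMeas n
  set Y := ∫ x, χ x * ‖x‖ ^ (-(2 * τ + 2)) * radialDefect f Df η x ∂ballMeas n
  set Y' := ∫ x, χ x * ‖x‖ ^ (-(2 * τ + 2 - ε)) * radialDefect f Df η x ∂ballMeas n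
  have hn : (n : ℝ) = 2 * τ + 2 - 2 * η := by rw [hη]; ring
  rw [hn] at hw
  have h1 : ε / 4 * X ≤ 1 / ε * Y' + R / 2 := by linarith [(abs_le.1 bm).1]
  have h2 := mul_le_mul_of_nonneg_left h1 (by positivity : 0 ≤ 4 * ε)
  have h3 : 4 * ε * (1 / ε * Y' + R / 2) = 4 * Y' + 2 * ε * R := by
    field_simp
    ring
  nlinarith

/-- The radial defect enters once directly and four times through the mass term, so 5·2(n+2)² gives
the constant 10(n+2)², which also absorbs 2ε. -/
theorem integral_carlemanLHS_le_of_nonneg (hst : IsDirStationary (Metric.ball 0 1) F f Df)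
    (h : IsSobolevSelection f Df) (hχ : IsCutoff χ) (hpos : ∀ x, 0 ≤ χ x) {τ ε : ℝ}
    (hτ : 0 < τ) (hε : 0 < ε) :
    ∫ x, carlemanLHS f Df τ ε χ x ∂ballMeas n ≤
      10 * (n + 2) ^ 2 * (1 + τ + 1 / τ + ε) * ∫ x, carlemanRHS f Df τ χ x ∂ballMeas n := by
  have h1 := (abs_le.1 (abs_integral_radialDefect_le hst h hχ hτ)).2
  have h2 := integral_mass_le h hχ hpos τ hε
  simp_rw [carlemanLHS_eq]
  rw [integral_add ((hχ.integrable _ h.integrable_sq).const_mul _)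
    (hχ.integrable _ (integrable_radialDefect h _)), integral_const_mul]
  have hR : 0 ≤ ∫ x, carlemanRHS f Df τ χ x ∂ballMeas n :=
    integral_nonneg fun x => carlemanRHS_nonneg _ _ _
  have h3 : 2 * ε * (∫ x, carlemanRHS f Df τ χ x ∂ballMeas n) ≤
      10 * (n + 2) ^ 2 * ε * ∫ x, carlemanRHS f Df τ χ x ∂ballMeas n := by
    gcongr
    have := Nat.cast_nonneg (α := ℝ) n
    nlinarith
  linarith

end Estimate

/-! ### Cutoffs of variable sign -/

section PositivePart

variable {n m Q : ℕ}

/-- A smooth function that vanishes on `(-∞, 0]` and is the identity on `[1, ∞)`. -/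
noncomputable def smoothPos (s : ℝ) : ℝ := s * Real.smoothTransition s

theorem contDiff_smoothPos : ContDiff ℝ ∞ smoothPos :=
  contDiff_id.mul Real.smoothTransition.contDiff

theorem smoothPos_of_nonpos {s : ℝ} (hs : s ≤ 0) : smoothPos s = 0 := by
  rw [smoothPos, Real.smoothTransition.zero_of_nonpos hs, mul_zero]

theorem smoothPos_of_one_le {s : ℝ} (hs : 1 ≤ s) : smoothPos s = s := by
  rw [smoothPos, Real.smoothTransition.one_of_one_le hs, mul_one]

theorem smoothPos_nonneg (s : ℝ) : 0 ≤ smoothPos s := by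
  rcases le_total s 0 with h | h
  · rw [smoothPos_of_nonpos h]
  · exact mul_nonneg h (Real.smoothTransition.nonneg s)

theorem abs_smoothPos_le (s : ℝ) : |smoothPos s| ≤ |s| := by
  rw [smoothPos, abs_mul, abs_of_nonneg (Real.smoothTransition.nonneg s)]
  exact mul_le_of_le_one_right (abs_nonneg _) (Real.smoothTransition.le_one s)

/-- The derivative is 0 to the left of [0,1], 1 to the right, and continuous on it. -/
theorem exists_abs_deriv_smoothPos_le : ∃ M, 0 < M ∧ ∀ s, |deriv smoothPos s| ≤ M := by
  have hc : Continuous (deriv smoothPos) := contDiff_smoothPos.continuous_deriv (by simp)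
  obtain ⟨M, hM⟩ := isCompact_Icc.exists_bound_of_continuousOn
    (hc.continuousOn (s := Set.Icc (0 : ℝ) 1))
  refine ⟨max M 1, by positivity, fun s => ?_⟩
  rcases lt_or_ge s 0 with h | h
  · have : smoothPos =ᶠ[𝓝 s] fun _ => 0 :=
      (eventually_lt_nhds h).mono fun y hy => smoothPos_of_nonpos hy.le
    rw [this.deriv_eq]
    simp
  rcases lt_or_ge 1 s with h1 | h1
  · have : smoothPos =ᶠ[𝓝 s] id :=
      (eventually_gt_nhds h1).mono fun y hy => smoothPos_of_one_le hy.le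
    rw [this.deriv_eq]
    simp
  · exact (hM s ⟨h, h1⟩).trans (le_max_left _ _)

/-- A smooth approximation of the positive part of `χ`. -/
noncomputable def posApprox (δ : ℝ) (χ : E n → ℝ) (x : E n) : ℝ := δ * smoothPos (δ⁻¹ * χ x)

theorem posApprox_eq_zero {δ : ℝ} {χ : E n → ℝ} {x : E n} (h : χ x = 0) :
    posApprox δ χ x = 0 := by
  simp [posApprox, h, smoothPos]

theorem IsCutoff.posApprox {χ : E n → ℝ} (hχ : IsCutoff χ) (δ : ℝ) :
    IsCutoff (posApprox δ χ) := by
  have hs : Function.support (QVal.posApprox δ χ) ⊆ Function.support χ := fun x hx h0 =>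
    hx (posApprox_eq_zero h0)
  refine ⟨contDiff_const.mul (contDiff_smoothPos.comp (contDiff_const.mul hχ.smooth)),
    hχ.compact.mono hs, (closure_mono hs).trans hχ.supp⟩

/-- The factors δ and δ⁻¹ cancel in the chain rule, so the bound is uniform in δ. -/
theorem norm_fderiv_posApprox_le {χ : E n → ℝ} (hχ : IsCutoff χ) {δ : ℝ} (hδ : 0 < δ) {M : ℝ}
    (hM : ∀ s, |deriv smoothPos s| ≤ M) (x : E n) :
    ‖fderiv ℝ (posApprox δ χ) x‖ ≤ M * ‖fderiv ℝ χ x‖ := by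
  have h1 : HasFDerivAt (fun y => δ⁻¹ * χ y) (δ⁻¹ • fderiv ℝ χ x) x :=
    (hχ.smooth.differentiable (by simp) x).hasFDerivAt.const_mul δ⁻¹
  have h2 := ((contDiff_smoothPos.differentiable (by simp)
    (δ⁻¹ * χ x)).hasDerivAt.comp_hasFDerivAt x h1).const_mul δ
  have h3 : fderiv ℝ (posApprox δ χ) x = _ := h2.fderiv
  rw [h3, smul_comm, smul_inv_smul₀ hδ.ne', norm_smul]
  exact mul_le_mul_of_nonneg_right (hM _) (norm_nonneg _)

theorem tendsto_posApprox (χ : E n → ℝ) (x : E n) :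
    Tendsto (fun k : ℕ => posApprox (1 / ((k : ℝ) + 1)) χ x) atTop (𝓝 (max (χ x) 0)) := by
  rcases le_or_gt (χ x) 0 with h | h
  · rw [max_eq_right h]
    refine tendsto_const_nhds.congr fun k => ?_
    rw [posApprox, smoothPos_of_nonpos, mul_zero]
    exact mul_nonpos_of_nonneg_of_nonpos (by positivity) h
  · rw [max_eq_left h.le]
    refine tendsto_const_nhds.congr' ?_
    filter_upwards [(tendsto_one_div_add_atTop_nhds_zero_nat (𝕜 := ℝ)).eventually_lt_const h]
      with k hk
    have hk0 : (0 : ℝ) < 1 / ((k : ℝ) + 1) := by positivity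
    rw [posApprox, smoothPos_of_one_le, mul_inv_cancel_left₀ hk0.ne']
    rw [← div_eq_inv_mul]
    exact (one_le_div₀ hk0).2 hk.le

variable {F : E n → AQ Q m} {f : Fin Q → E n → E m} {Df : Fin Q → E n → E n →L[ℝ] E m}

/-- Each approximation of the positive part of χ is an admissible nonnegative cutoff, bounded by |χ|
and with gradient at most M|Dχ|; dominated convergence carries the estimate to max(χ, 0). -/
theorem integral_carlemanLHS_le (hst : IsDirStationary (Metric.ball 0 1) F f Df)
    (h : IsSobolevSelection f Df) {χ : E n → ℝ} (hχ : IsCutoff χ) {M : ℝ}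
    (hM : ∀ s, |deriv smoothPos s| ≤ M) {τ ε : ℝ} (hτ : 0 < τ) (hε : 0 < ε) :
    ∫ x, carlemanLHS f Df τ ε χ x ∂ballMeas n ≤
      10 * (n + 2) ^ 2 * M * (1 + τ + 1 / τ + ε) * ∫ x, carlemanRHS f Df τ χ x ∂ballMeas n := by
  set W : E n → ℝ := fun x => ∑ i, (ε ^ 2 * (‖f i x‖ ^ 2 / ‖x‖ ^ (2 * τ + 2 - ε)) +
    ‖Df i x x - ((2 * τ - n + 2) / 2) • f i x‖ ^ 2 / ‖x‖ ^ (2 * τ + 2))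
  have hW : ∀ x, 0 ≤ W x := fun x => Finset.sum_nonneg fun i _ => by positivity
  have hI := integrable_carlemanLHS h hχ τ ε
  set χk : ℕ → E n → ℝ := fun k => posApprox (1 / ((k : ℝ) + 1)) χ
  have hk0 : ∀ k : ℕ, (0 : ℝ) < 1 / ((k : ℝ) + 1) := fun k => by positivity
  have hle : ∀ k x, |χk k x| ≤ |χ x| := fun k x => by
    have h1 := abs_smoothPos_le ((1 / ((k : ℝ) + 1))⁻¹ * χ x)
    rw [abs_mul, abs_of_pos (inv_pos.2 (hk0 k))] at h1
    change |1 / ((k : ℝ) + 1) * smoothPos _| ≤ _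
    rw [abs_mul, abs_of_pos (hk0 k)]
    calc _ ≤ 1 / ((k : ℝ) + 1) * ((1 / ((k : ℝ) + 1))⁻¹ * |χ x|) := by gcongr
      _ = |χ x| := mul_inv_cancel_left₀ (hk0 k).ne' _
  have hlim : Tendsto (fun k => ∫ x, carlemanLHS f Df τ ε (χk k) x ∂ballMeas n) atTop
      (𝓝 (∫ x, max (χ x) 0 * W x ∂ballMeas n)) := by
    refine tendsto_integral_of_dominated_convergence (fun x => ‖carlemanLHS f Df τ ε χ x‖)
      (fun k => (integrable_carlemanLHS h (hχ.posApprox _) τ ε).aestronglyMeasurable) hI.norm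
      (fun k => ae_of_all _ fun x => ?_)
      (ae_of_all _ fun x => (tendsto_posApprox χ x).mul_const (W x))
    change ‖χk k x * W x‖ ≤ ‖χ x * W x‖
    rw [norm_mul, norm_mul]
    exact mul_le_mul_of_nonneg_right (hle k x) (norm_nonneg _)
  have hbound : ∀ k, ∫ x, carlemanLHS f Df τ ε (χk k) x ∂ballMeas n ≤
      10 * (n + 2) ^ 2 * M * (1 + τ + 1 / τ + ε) *
        ∫ x, carlemanRHS f Df τ χ x ∂ballMeas n := by
    intro k
    refine (integral_carlemanLHS_le_of_nonneg hst h (hχ.posApprox _)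
      (fun x => mul_nonneg (hk0 k).le (smoothPos_nonneg _)) hτ hε).trans ?_
    have h1 : ∫ x, carlemanRHS f Df τ (χk k) x ∂ballMeas n ≤
        M * ∫ x, carlemanRHS f Df τ χ x ∂ballMeas n := by
      rw [← integral_const_mul]
      refine integral_mono (integrable_carlemanRHS h (hχ.posApprox _) τ)
        ((integrable_carlemanRHS h hχ τ).const_mul M) fun x => ?_
      simp only [carlemanRHS]
      rw [← mul_assoc]
      refine mul_le_mul_of_nonneg_right (norm_fderiv_posApprox_le hχ (hk0 k) hM x) ?_
      exact Finset.sum_nonneg fun i _ => add_nonneg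
        (div_nonneg (hsInner_self_nonneg _) (by positivity)) (by positivity)
    calc _ ≤ 10 * ((n : ℝ) + 2) ^ 2 * (1 + τ + 1 / τ + ε) *
          (M * ∫ x, carlemanRHS f Df τ χ x ∂ballMeas n) := by gcongr
      _ = _ := by ring
  -- The weight W is nonnegative, so replacing χ by its positive part only increases the left-hand
  -- side.
  refine le_trans ?_ (le_of_tendsto' hlim hbound)
  have hmax : Integrable (fun x => max (χ x) 0 * W x) (ballMeas n) := by
    have e : (fun x => max (χ x) 0 * W x) = fun x => max (carlemanLHS f Df τ ε χ x) 0 := by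
      funext x
      change _ = max (χ x * W x) 0
      rw [max_mul_of_nonneg _ _ (hW x), zero_mul]
    rw [e]
    exact hI.pos_part
  exact integral_mono hI hmax fun x => mul_le_mul_of_nonneg_right (le_max_left _ _) (hW x)

end PositivePart

end QVal

/-! ### The Carleman estimate -/

open QVal in
theorem theorem1p1 (n : ℕ) :
    ∃ C : ℝ, 0 < C ∧
      ∀ (m Q : ℕ) (F : E n → AQ Q m) (f : Fin Q → E n → E m)
        (Df : Fin Q → E n → E n →L[ℝ] E m),
        IsDirStationary (Metric.ball 0 1) F f Df →
      ∀ τ ε : ℝ, 0 < τ → 0 < ε →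
      ∀ χ : E n → ℝ, ContDiff ℝ ∞ χ → HasCompactSupport χ →
        tsupport χ ⊆ Metric.ball 0 1 \ {0} →
        IntegrableOn (carlemanLHS f Df τ ε χ) (Metric.ball 0 1) ∧
        IntegrableOn (carlemanRHS f Df τ χ) (Metric.ball 0 1) ∧
        ∫ x in Metric.ball (0 : E n) 1, carlemanLHS f Df τ ε χ x ≤
          C * (1 + τ + 1 / τ + ε) *
            ∫ x in Metric.ball (0 : E n) 1, carlemanRHS f Df τ χ x := by
  obtain ⟨M, hM0, hM⟩ := exists_abs_deriv_smoothPos_le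
  -- M belongs to one fixed function on the real line, so the constant depends only on n.
  refine ⟨10 * (n + 2) ^ 2 * M, by positivity, ?_⟩
  intro m Q F f Df hst τ ε hτ hε χ hs hc hsupp
  have h := isSobolevSelection hst.memW12 hst.selection
  have hχ : IsCutoff χ := ⟨hs, hc, hsupp⟩
  exact ⟨integrable_carlemanLHS h hχ τ ε, integrable_carlemanRHS h hχ τ,
    integral_carlemanLHS_le hst h hχ hM hτ hε⟩
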